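/- Let $d,T\in\mathbb N$. Regard $\mathbb{R}^{dT}$, with the Euclidean norm $|\cdot|$, as the space of $d$-dimensional paths $x=(x_1,\dots,x_T)$, and write $x_{1:t}=(x_1,\dots,x_t)$ and $x_{t+1:T}=(x_{t+1},\dots,x_T)$. For a probability measure $\mu$ on $\mathbb{R}^{dT}$ let $\mu_{x_{1:t}}$ be the regular conditional law of $x_{t+1:T}$ given $x_{1:t}$; for a probability measure $\pi$ on $\mathbb{R}^{dT}\times\mathbb{R}^{dT}$ let $\pi_{x_{1:t},y_{1:t}}$ be the regular conditional law of $(x_{t+1:T},y_{t+1:T})$ given $(x_{1:t},y_{1:t})$. A coupling $\pi$ of $\mu$ and $\nu$ is *bi-causal* if, for all $t=1,\dots,T-1$ and $\pi$-almost all $(x,y)$, $\pi_{x_{1:t},y_{1:t}}$ is a coupling of $\mu_{x_{1:t}}$ and $\nu_{y_{1:t}}$; the set of these couplings is denoted by $\mathrm{Cpl}_{\mathrm{bc}}(\mu,\nu)$. For $\lambda\ge 0$ set $$\mathcal{AW}_{2,\lambda}^2(\mu,\nu)=\inf_{\pi\in\mathrm{Cpl}_{\mathrm{bc}}(\mu,\nu)}\Big(\int|x-y|^2\,d\pi+\lambda\,\mathcal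 D_{\mathrm{KL}}(\pi\,|\,\mu\otimes\nu)\Big),\qquad \mathcal{AW}_2^2(\mu,\nu)=\inf_{\pi\in\mathrm{Cpl}_{\mathrm{bc}}(\mu,\nu)}\int|x-y|^2\,d\pi,$$ with the convention $0\cdot\infty=0$, where $\mathcal D_{\mathrm{KL}}$ is the Kullback–Leibler divergence. Let $f_\lambda(0)=0$ and $f_\lambda(x)=\mathrm{sign}(x)\Big(\sqrt{\big(\tfrac{\lambda}{4|x|}\big)^2+1}-\tfrac{\lambda}{4|x|}\Big)$ for $x\neq0$; for a matrix, $f_\lambda$ is applied entrywise. **Theorem (closed-form representation).** Let $\mu=\mathcal N(a,A)$ and $\nu=\mathcal N(b,B)$ be Gaussian measures on $\mathbb{R}^{dT}$ with positive definite covariance matrices $A=LL^\top$ and $B=MM^\top$, where $L,M\in\mathbb{R}^{dT\times dT}$ are lower triangular (in particular, for the Cholesky decompositions). For $t=1,\dots,T$ let $S_t$ be the $d\times d$ diagonal matrix of the singular values of the $t$-th diagonal $d\times d$ block $(M^\top L)_{t,t}$, let $S=\mathrm{diag}(S_1,\dots,S_T)$, and let $D_\lambda=f_\lambda(S)$. Then: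 1. For every $\lambda\ge0$, $$\mathcal{AW}_{2,\lambda}^2(\mu,\nu)=|a-b|^2+\mathrm{tr}(A+B)-2\,\mathrm{tr}(D_\lambda S)-\frac{\lambda}{2}\log\det(I-D_\lambda^2),$$ where the last term is read as $0$ if $\lambda=0$. 2. The function $f_0$ is the sign function (with $\mathrm{sign}(0)=0$), and $$\mathcal{AW}_2^2(\mu,\nu)=|a-b|^2+\mathrm{tr}(A+B)-2\,\mathrm{tr}(S).$$ 3. $\lim_{\lambda\downarrow0}\mathcal{AW}_{2,\lambda}^2(\mu,\nu)=\mathcal{AW}_2^2(\mu,\nu)$. 4. If $d=1$, then the formula in 1 also holds for every $\lambda\ge0$ with $S$ replaced by the diagonal matrix $N=\mathrm{diag}\big([(M^\top L)_{tt}]_{t=1}^{T}\big)$ and $D_\lambda$ replaced by $P_\lambda=f_\lambda(N)$. -/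

import Mathlib

open MeasureTheory ProbabilityTheory Filter Topology
open scoped ENNReal Matrix

noncomputable section

namespace AdaptedOT

/-- The space `ℝ^{dT}` of `d`-dimensional paths with `T` time steps, with its Euclidean norm.
The coordinate `(t, i)` is the `i`-th component of the path at the `t`-th time step. -/
abbrev PathSpace (T d : ℕ) : Type := EuclideanSpace ℝ (Fin T × Fin d)

variable {T d : ℕ}

/-- The first `t` time steps `x_{1:t}` of a path. -/
def past (t : ℕ) (x : PathSpace T d) : {s : Fin T // s.val < t} × Fin d → ℝ :=
  fun p => x (p.1.val, p.2)

/-- The time steps `x_{t+1:T}` of a path that come after the first `t` ones. -/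
def future (t : ℕ) (x : PathSpace T d) : {s : Fin T // t ≤ s.val} × Fin d → ℝ :=
  fun p => x (p.1.val, p.2)

/-- The kernel `x_{1:t} ↦ μ_{x_{1:t}}`: the regular conditional law under `μ` of the future
`x_{t+1:T}` given the past `x_{1:t}`. -/
def pathKernel (t : ℕ) (μ : Measure (PathSpace T d)) [IsFiniteMeasure μ] :
    Kernel ({s : Fin T // s.val < t} × Fin d → ℝ) ({s : Fin T // t ≤ s.val} × Fin d → ℝ) :=
  condDistrib (future t) (past t) μ

/-- The kernel `(x_{1:t}, y_{1:t}) ↦ π_{x_{1:t}, y_{1:t}}`: the regular conditional law under `π`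
of the pair of futures given the pair of pasts. -/
def pairKernel (t : ℕ) (π : Measure (PathSpace T d × PathSpace T d)) [IsFiniteMeasure π] :
    Kernel (({s : Fin T // s.val < t} × Fin d → ℝ) × ({s : Fin T // s.val < t} × Fin d → ℝ))
      (({s : Fin T // t ≤ s.val} × Fin d → ℝ) × ({s : Fin T // t ≤ s.val} × Fin d → ℝ)) :=
  condDistrib (fun z => (future t z.1, future t z.2)) (fun z => (past t z.1, past t z.2)) π

/-- `π` is a coupling of `μ` and `ν`: its first marginal is `μ` and its second marginal is `ν`. -/
def IsCoupling {X Y : Type*} [MeasurableSpace X] [MeasurableSpace Y]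
    (μ : Measure X) (ν : Measure Y) (π : Measure (X × Y)) : Prop :=
  π.map Prod.fst = μ ∧ π.map Prod.snd = ν

/-- `π` is a bi-causal coupling of `μ` and `ν`: it is a coupling, and for `t = 1, …, T - 1` the
conditional law `π_{x_{1:t}, y_{1:t}}` is a coupling of `μ_{x_{1:t}}` and `ν_{y_{1:t}}`, for
`π`-almost every `(x, y)` (conditional laws are determined only up to null sets). -/
def IsBicausalCoupling (μ ν : Measure (PathSpace T d)) [IsFiniteMeasure μ] [IsFiniteMeasure ν]
    (π : Measure (PathSpace T d × PathSpace T d)) [IsFiniteMeasure π] : Prop :=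
  IsCoupling μ ν π ∧
    ∀ t : ℕ, 1 ≤ t → t < T → ∀ᵐ z ∂π,
      IsCoupling (pathKernel t μ (past t z.1)) (pathKernel t ν (past t z.2))
        (pairKernel t π (past t z.1, past t z.2))

/-- The entropic transport cost `∫ |x - y|² dπ + lam * KL(π | μ ⊗ ν)`, with values in `[0, ∞]`
and with the convention `0 * ∞ = 0`, so that the entropy is absent for `lam = 0`. -/
def entropicCost (lam : ℝ) (μ ν : Measure (PathSpace T d))
    (π : Measure (PathSpace T d × PathSpace T d)) : ℝ≥0∞ :=
  (∫⁻ z, ENNReal.ofReal (‖z.1 - z.2‖ ^ 2) ∂π) +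
    ENNReal.ofReal lam * InformationTheory.klDiv π (μ.prod ν)

/-- The square of the entropic adapted 2-Wasserstein distance: the infimum of the entropic
transport cost over all bi-causal couplings. -/
def entropicAWSq (lam : ℝ) (μ ν : Measure (PathSpace T d)) [IsFiniteMeasure μ]
    [IsFiniteMeasure ν] : ℝ≥0∞ :=
  ⨅ (π : ProbabilityMeasure (PathSpace T d × PathSpace T d))
    (_ : IsBicausalCoupling μ ν (π : Measure (PathSpace T d × PathSpace T d))),
    entropicCost lam μ ν (π : Measure (PathSpace T d × PathSpace T d))

/-- The square of the (unregularized) adapted 2-Wasserstein distance: the infimum of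
`∫ |x - y|² dπ` over all bi-causal couplings. -/
def adaptedWSq (μ ν : Measure (PathSpace T d)) [IsFiniteMeasure μ] [IsFiniteMeasure ν] : ℝ≥0∞ :=
  ⨅ (π : ProbabilityMeasure (PathSpace T d × PathSpace T d))
    (_ : IsBicausalCoupling μ ν (π : Measure (PathSpace T d × PathSpace T d))),
    ∫⁻ z, ENNReal.ofReal (‖z.1 - z.2‖ ^ 2) ∂(π : Measure (PathSpace T d × PathSpace T d))

/-- The function `f_lam`. -/
def fLam (lam x : ℝ) : ℝ :=
  if x = 0 then 0
  else Real.sign x * (Real.sqrt ((lam / (4 * |x|)) ^ 2 + 1) - lam / (4 * |x|))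

/-- `L` is lower triangular as a `dT × dT` matrix, where the coordinates are ordered by time step
and, within one time step, by component. -/
def IsLowerTriangular (L : Matrix (Fin T × Fin d) (Fin T × Fin d) ℝ) : Prop :=
  ∀ p q : Fin T × Fin d, (p.1 < q.1 ∨ (p.1 = q.1 ∧ p.2 < q.2)) → L p q = 0

/-- The `t`-th diagonal `d × d` block `N_{t,t}` of a `dT × dT` matrix `N`. -/
def diagBlock (N : Matrix (Fin T × Fin d) (Fin T × Fin d) ℝ) (t : Fin T) :
    Matrix (Fin d) (Fin d) ℝ :=
  Matrix.of fun i j => N (t, i) (t, j)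

/-- `diag(S_1, …, S_T)`, where `S_t` is the diagonal matrix of the singular values (counted with
multiplicity, in decreasing order) of the diagonal block `N_{t,t}`. -/
def singularDiag (N : Matrix (Fin T × Fin d) (Fin T × Fin d) ℝ) :
    Matrix (Fin T × Fin d) (Fin T × Fin d) ℝ :=
  Matrix.diagonal fun p =>
    (Matrix.toEuclideanLin (diagBlock N p.1)).singularValues (p.2 : ℕ)

/-- The right-hand side
`|a - b|² + tr(A + B) - 2 tr(f_lam(S) S) - (lam / 2) log det(I - f_lam(S)²)`
of the closed formula, with `f_lam` applied entrywise to the matrix `S`. -/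
def closedForm (lam : ℝ) (a b : PathSpace T d)
    (A B S : Matrix (Fin T × Fin d) (Fin T × Fin d) ℝ) : ℝ :=
  ‖a - b‖ ^ 2 + (A + B).trace - 2 * (S.map (fLam lam) * S).trace
    - lam / 2 * Real.log (1 - S.map (fLam lam) ^ 2).det

end AdaptedOT

end

/-!
The noises `ξ = L⁻¹ (x - a)` and `η = M⁻¹ (y - b)` turn a coupling of the two Gaussian laws into a
coupling of white noises. As `L` and `M` are block lower triangular, the past of a path and the past
of its noise determine each other, so a coupling is bi-causal exactly when, at each time, the later
part of `ξ`, and likewise that of `η`, is independent of the pair of pasts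
(`isBicausalCoupling_iff`). Noises at different times are then uncorrelated, and the transport cost
is `|a - b|² + tr (A + B) - 2 ∑ₜ tr ((Mᵀ L)ₜₜ E[ξₜ ηₜᵀ])`.

Replacing `L` and `M` by `L V` and `M U` with `U` and `V` block diagonal and orthogonal changes
neither the covariances nor block triangularity, and by the singular value decomposition of the
diagonal blocks it makes `(Mᵀ L)ₜₜ` diagonal (`exists_factor_singularDiag`). With `n p` the diagonal
entries, of any sign, and `c p = E[ξ p η p]`, the cost becomes
`|a - b|² + tr (A + B) - 2 ∑ n p c p` (`IsBicausalCoupling.lintegral_norm_sq`).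

For `lam > 0`, let `ρ p = fLam lam (n p)`, and let `φ` be the log-density with respect to `μ ⊗ ν` of
the coupling under which the pairs `(ξ p, η p)` are independent over `p` and Gaussian with
correlation `ρ p` (`corrCoupling`). Every coupling `π` has relative entropy at least `∫ φ ∂π`
(`IsCoupling.ofReal_le_klDiv`), an affine function of the `c p`. The equation
`lam ρ = 2 n (1 - ρ²)` solved by `ρ p` makes the `c p` cancel from the sum of the cost and `lam`
times this bound, which leaves the closed formula; `corrCoupling` attains it (`entropicAWSq_eq`).
For `lam = 0`, the bound `|c p| ≤ 1` gives `-2 ∑ |n p|`, which is approached by `ρ p = r sign (n p)`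
as `r ↑ 1`. The limit `lam ↓ 0` is that of the closed formula. For `d = 1` the diagonal blocks are
diagonal from the start, and no singular value decomposition is needed.
-/

namespace AdaptedOT

/-! ### Entropy and densities -/

/-- The Donsker–Varadhan lower bound for a normalised exponential density. It is Gibbs' inequality
for `P` relative to the probability measure with density `exp f` with respect to `m`. -/
theorem ofReal_integral_le_klDiv {Ω : Type*} [MeasurableSpace Ω] (P m : Measure Ω)
    [IsProbabilityMeasure P] [IsProbabilityMeasure m] {f : Ω → ℝ} (hf : Integrable f P)
    (hfm : Integrable (fun x => Real.exp (f x)) m) (hone : ∫ x, Real.exp (f x) ∂m = 1) :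
    ENNReal.ofReal (∫ x, f x ∂P) ≤ InformationTheory.klDiv P m := by
  by_cases h : P ≪ m ∧ Integrable (llr P m) P
  · obtain ⟨hac, hint⟩ := h
    have : IsProbabilityMeasure (m.tilted f) := isProbabilityMeasure_tilted hfm
    have h1 := integral_llr_tilted_right hac hf hfm hint
    have h2 := InformationTheory.integral_llr_add_sub_measure_univ_nonneg
      (hac.trans (absolutelyContinuous_tilted hfm)) (integrable_llr_tilted_right hac hf hint hfm)
    rw [InformationTheory.klDiv_of_ac_of_integrable hac hint]
    apply ENNReal.ofReal_le_ofReal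
    simp only [probReal_univ, hone, Real.log_one] at *
    linarith
  · rw [InformationTheory.klDiv_eq_top_iff.2 (by tauto)]
    exact le_top

theorem klDiv_withDensity_exp {Ω : Type*} [MeasurableSpace Ω] (P m : Measure Ω)
    [IsProbabilityMeasure P] [IsProbabilityMeasure m] {f : Ω → ℝ} (hfm : Measurable f)
    (hf : Integrable f P) (hP : P = m.withDensity fun x => ENNReal.ofReal (Real.exp (f x))) :
    InformationTheory.klDiv P m = ENNReal.ofReal (∫ x, f x ∂P) := by
  have hac : P ≪ m := hP ▸ withDensity_absolutelyContinuous _ _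
  have hllr : llr P m =ᵐ[P] f := by
    refine hac.ae_le ?_
    have := Measure.rnDeriv_withDensity m
      (f := fun x => ENNReal.ofReal (Real.exp (f x))) (by fun_prop)
    rw [← hP] at this
    filter_upwards [this] with x hx
    rw [llr, hx, ENNReal.toReal_ofReal (Real.exp_pos _).le, Real.log_exp]
  rw [InformationTheory.klDiv_of_ac_of_integrable hac ((integrable_congr hllr).2 hf),
    integral_congr_ae hllr]
  simp

/-- A product of probability measures with densities has the product density. -/
theorem pi_withDensity {ι : Type*} [Fintype ι] {E : ι → Type*} [∀ i, MeasurableSpace (E i)]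
    (μ : ∀ i, Measure (E i)) [∀ i, IsProbabilityMeasure (μ i)] (f : ∀ i, E i → ℝ≥0∞)
    (hf : ∀ i, Measurable (f i)) [∀ i, IsProbabilityMeasure ((μ i).withDensity (f i))] :
    Measure.pi (fun i => (μ i).withDensity (f i)) =
      (Measure.pi μ).withDensity fun x => ∏ i, f i (x i) := by
  refine Measure.pi_eq fun s hs => ?_
  rw [withDensity_apply _ (MeasurableSet.univ_pi hs), ← lintegral_indicator (.univ_pi hs)]
  have h1 : (fun x => (Set.univ.pi s).indicator (fun x => ∏ i, f i (x i)) x) =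
      fun x => ∏ i, (s i).indicator (f i) (x i) := by
    funext x
    by_cases hx : x ∈ Set.univ.pi s
    · rw [Set.indicator_of_mem hx]
      exact Finset.prod_congr rfl fun i _ =>
        (Set.indicator_of_mem (hx i (Set.mem_univ i)) _).symm
    · rw [Set.indicator_of_notMem hx]
      simp only [Set.mem_pi, Set.mem_univ, true_implies, not_forall] at hx
      obtain ⟨i, hi⟩ := hx
      exact (Finset.prod_eq_zero (Finset.mem_univ i) (Set.indicator_of_notMem hi _)).symm
  have hmeas : ∀ i, Measurable fun y => (s i).indicator (f i) y := fun i => (hf i).indicator (hs i)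
  rw [h1, lintegral_prod_eq_prod_lintegral_of_indepFun _
    (fun i (x : ∀ i, E i) => (s i).indicator (f i) (x i))
    (iIndepFun_pi (X := fun i => (s i).indicator (f i)) fun i => (hmeas i).aemeasurable)
    fun i => (hmeas i).comp (measurable_pi_apply i)]
  refine Finset.prod_congr rfl fun i _ => ?_
  rw [(measurePreserving_eval μ i).lintegral_comp (hmeas i), withDensity_apply _ (hs i),
    lintegral_indicator (hs i)]

theorem map_withDensity_comp {α β : Type*} [MeasurableSpace α] [MeasurableSpace β]
    (m : Measure α) {e : α → β} (he : Measurable e) {f : β → ℝ≥0∞} (hf : Measurable f) :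
    (m.withDensity (f ∘ e)).map e = (m.map e).withDensity f := by
  ext s hs
  rw [Measure.map_apply he hs, withDensity_apply _ (he hs), withDensity_apply _ hs,
    setLIntegral_map hs hf he]
  rfl

/-! ### Correlated Gaussian pairs -/

/-- The logarithm of the density, relative to two independent standard Gaussians, of a centred
Gaussian pair with unit variances and correlation `ρ`. It is meaningful for `ρ ^ 2 < 1`. -/
noncomputable def corrLogDensity (ρ : ℝ) (z : ℝ × ℝ) : ℝ :=
  -(Real.log (1 - ρ ^ 2)) / 2 - (ρ ^ 2 * (z.1 ^ 2 + z.2 ^ 2) - 2 * ρ * (z.1 * z.2)) /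
    (2 * (1 - ρ ^ 2))

@[fun_prop]
theorem measurable_corrLogDensity (ρ : ℝ) : Measurable (corrLogDensity ρ) := by
  unfold corrLogDensity; fun_prop

theorem corrLogDensity_swap (ρ : ℝ) (z : ℝ × ℝ) :
    corrLogDensity ρ z.swap = corrLogDensity ρ z := by
  simp only [corrLogDensity, Prod.fst_swap, Prod.snd_swap]; ring

/-- Given that the first coordinate is `x`, the second one has law `N(ρ x, 1 - ρ ^ 2)`. -/
theorem withDensity_corrLogDensity_right {ρ : ℝ} (hρ : ρ ^ 2 < 1) (x : ℝ) :
    (gaussianReal 0 1).withDensity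
      (fun y => ENNReal.ofReal (Real.exp (corrLogDensity ρ (x, y)))) =
      gaussianReal (ρ * x) (1 - ρ ^ 2).toNNReal := by
  have hv : 0 < 1 - ρ ^ 2 := by linarith
  rw [gaussianReal_of_var_ne_zero _ one_ne_zero,
    gaussianReal_of_var_ne_zero _ (Real.toNNReal_pos.2 hv).ne',
    ← withDensity_mul _ (measurable_gaussianPDF 0 1) (by fun_prop)]
  congr 1
  funext y
  simp only [Pi.mul_apply, gaussianPDF]
  rw [← ENNReal.ofReal_mul (gaussianPDFReal_nonneg _ _ _)]
  congr 1
  simp only [gaussianPDFReal, Real.coe_toNNReal _ hv.le, NNReal.coe_one, corrLogDensity]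
  have h1 : (√(1 - ρ ^ 2))⁻¹ = Real.exp (-(Real.log (1 - ρ ^ 2)) / 2) := by
    rw [Real.sqrt_eq_rpow, ← Real.rpow_neg hv.le, Real.rpow_def_of_pos hv]
    congr 1; ring
  rw [Real.sqrt_mul (by positivity) (1 - ρ ^ 2), mul_one, mul_inv, h1]
  simp only [mul_assoc (√(2 * Real.pi))⁻¹, ← Real.exp_add]
  congr 2
  field_simp
  ring

/-- The law of a centred Gaussian pair with unit variances and correlation `ρ`, for `ρ ^ 2 < 1`. -/
noncomputable def corrGaussian (ρ : ℝ) : Measure (ℝ × ℝ) :=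
  ((gaussianReal 0 1).prod (gaussianReal 0 1)).withDensity
    fun z => ENNReal.ofReal (Real.exp (corrLogDensity ρ z))

theorem lintegral_corrGaussian {ρ : ℝ} (hρ : ρ ^ 2 < 1) {g : ℝ × ℝ → ℝ≥0∞} (hg : Measurable g) :
    ∫⁻ z, g z ∂(corrGaussian ρ) =
      ∫⁻ x, ∫⁻ y, g (x, y) ∂(gaussianReal (ρ * x) (1 - ρ ^ 2).toNNReal) ∂(gaussianReal 0 1) := by
  rw [corrGaussian, lintegral_withDensity_eq_lintegral_mul _ (by fun_prop) hg,
    lintegral_prod _ (by fun_prop)]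
  congr 1
  funext x
  rw [← withDensity_corrLogDensity_right hρ, lintegral_withDensity_eq_lintegral_mul _ (by fun_prop)
    (by fun_prop)]
  rfl

theorem corrGaussian_map_fst {ρ : ℝ} (hρ : ρ ^ 2 < 1) :
    (corrGaussian ρ).map Prod.fst = gaussianReal 0 1 := by
  ext s hs
  rw [← lintegral_indicator_one hs, lintegral_map (measurable_one.indicator hs) measurable_fst,
    lintegral_corrGaussian hρ (g := fun z => s.indicator 1 z.1)
      ((measurable_one.indicator hs).comp measurable_fst)]
  simp only [lintegral_const, measure_univ, mul_one]
  exact lintegral_indicator_one hs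

theorem corrGaussian_map_swap (ρ : ℝ) : (corrGaussian ρ).map Prod.swap = corrGaussian ρ := by
  have h : (fun z => ENNReal.ofReal (Real.exp (corrLogDensity ρ z))) =
      (fun z => ENNReal.ofReal (Real.exp (corrLogDensity ρ z))) ∘ Prod.swap := by
    funext z; simp only [Function.comp, corrLogDensity_swap]
  rw [corrGaussian]
  conv_lhs => rw [h]
  rw [map_withDensity_comp _ measurable_swap (by fun_prop), Measure.prod_swap]

theorem corrGaussian_map_snd {ρ : ℝ} (hρ : ρ ^ 2 < 1) :
    (corrGaussian ρ).map Prod.snd = gaussianReal 0 1 := by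
  rw [← corrGaussian_map_fst hρ]
  conv_rhs => rw [← corrGaussian_map_swap, Measure.map_map measurable_fst measurable_swap]
  rfl

theorem isProbabilityMeasure_corrGaussian {ρ : ℝ} (hρ : ρ ^ 2 < 1) :
    IsProbabilityMeasure (corrGaussian ρ) := by
  constructor
  have := congrArg (fun m => m Set.univ) (corrGaussian_map_fst hρ)
  simpa [Measure.map_apply measurable_fst] using this

theorem memLp_of_map_eq_gaussianReal {Ω : Type*} [MeasurableSpace Ω] {P : Measure Ω} {X : Ω → ℝ}
    (hX : Measurable X) (h : P.map X = gaussianReal 0 1) : MemLp X 2 P := by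
  have := memLp_id_gaussianReal (μ := 0) (v := 1) 2
  rw [← h, memLp_map_measure_iff (by fun_prop) hX.aemeasurable] at this
  exact this

theorem integral_sq_of_map_eq_gaussianReal {Ω : Type*} [MeasurableSpace Ω] {P : Measure Ω}
    {X : Ω → ℝ} (hX : Measurable X) (h : P.map X = gaussianReal 0 1) :
    ∫ ω, X ω ^ 2 ∂P = 1 := by
  have h1 : ∫ x, x ^ 2 ∂(P.map X) = ∫ ω, X ω ^ 2 ∂P :=
    integral_map hX.aemeasurable (by fun_prop)
  rw [← h1, h]
  have := variance_fun_id_gaussianReal (μ := 0) (v := 1)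
  rw [variance_of_integral_eq_zero (by fun_prop) (by simp)] at this
  simpa using this

theorem integral_mul_corrGaussian {ρ : ℝ} (hρ : ρ ^ 2 < 1) :
    ∫ z, z.1 * z.2 ∂(corrGaussian ρ) = ρ := by
  have hint : Integrable (fun z : ℝ × ℝ => z.1 * z.2) (corrGaussian ρ) :=
    (memLp_of_map_eq_gaussianReal measurable_fst (corrGaussian_map_fst hρ)).integrable_mul
      (memLp_of_map_eq_gaussianReal measurable_snd (corrGaussian_map_snd hρ))
  rw [corrGaussian] at hint ⊢
  rw [integrable_withDensity_iff_integrable_smul' (by fun_prop) (by simp)] at hint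
  rw [integral_withDensity_eq_integral_toReal_smul (by fun_prop) (by simp), integral_prod _ hint]
  have h : ∀ x : ℝ, ∫ y, (ENNReal.ofReal (Real.exp (corrLogDensity ρ (x, y)))).toReal •
      ((x, y).1 * (x, y).2) ∂(gaussianReal 0 1) = ρ * x ^ 2 := by
    intro x
    rw [← integral_withDensity_eq_integral_toReal_smul (by fun_prop) (by simp)
      (g := fun y => (x, y).1 * (x, y).2), withDensity_corrLogDensity_right hρ]
    rw [integral_const_mul, integral_id_gaussianReal]
    ring
  simp_rw [h]
  rw [integral_const_mul, integral_sq_of_map_eq_gaussianReal (X := fun x => x) measurable_id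
    Measure.map_id]
  ring

/-! ### Conditional laws driven by independent noise -/

section CondDistrib

variable {Ω α β γ υ : Type*} [MeasurableSpace Ω] [MeasurableSpace α] [MeasurableSpace β]
  [MeasurableSpace γ] [MeasurableSpace υ]

theorem ae_condDistrib_eq_iff [StandardBorelSpace γ] [Nonempty γ]
    {π : Measure Ω} [IsFiniteMeasure π] {P : Ω → α} {Y : Ω → γ}
    (hP : Measurable P) (hY : Measurable Y) (η : Kernel α γ) [IsFiniteKernel η] :
    (∀ᵐ ω ∂π, condDistrib Y P π (P ω) = η (P ω)) ↔
      π.map (fun ω => (P ω, Y ω)) = π.map P ⊗ₘ η := by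
  constructor
  · intro h
    rw [← compProd_map_condDistrib hY.aemeasurable]
    ext s hs
    rw [Measure.compProd_apply hs, Measure.compProd_apply hs,
      lintegral_map (Kernel.measurable_kernel_prodMk_left hs) hP,
      lintegral_map (Kernel.measurable_kernel_prodMk_left hs) hP]
    refine lintegral_congr_ae ?_
    filter_upwards [h] with ω hω
    rw [hω]
  · intro h
    exact ae_of_ae_map hP.aemeasurable
      (condDistrib_ae_eq_of_measure_eq_compProd P hY.aemeasurable h)

/-- The conditional law of `h (u, W)` given `u`, for `W` of law `ρ` independent of `u`. -/
noncomputable def noiseKernel (ρ : Measure β) (h : υ × β → γ) : Kernel υ γ :=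
  (Kernel.id ×ₖ Kernel.const υ ρ).map h

instance (ρ : Measure β) [IsProbabilityMeasure ρ] (h : υ × β → γ) :
    IsFiniteKernel (noiseKernel ρ h) := by
  unfold noiseKernel; infer_instance

theorem noiseKernel_apply (ρ : Measure β) [IsProbabilityMeasure ρ] {h : υ × β → γ}
    (hh : Measurable h) (u : υ) : noiseKernel ρ h u = ρ.map fun w => h (u, w) := by
  rw [noiseKernel, Kernel.map_apply _ hh, Kernel.prod_apply, Kernel.id_apply, Kernel.const_apply,
    Measure.dirac_prod, Measure.map_map hh (by fun_prop)]
  rfl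

/-- If `Y = h (u (P), W)` and `W` can be recovered from `u (P)` and `Y`, then the conditional law of
`Y` given `P` is that of `h (u (P), W')` with `W'` of law `ρ` independent of `P` exactly when `W` has
law `ρ` and is independent of `P`. -/
theorem ae_condDistrib_eq_noiseKernel_iff [StandardBorelSpace γ] [Nonempty γ]
    {π : Measure Ω} [IsProbabilityMeasure π] {P : Ω → α}
    {W : Ω → β} (hP : Measurable P) (hW : Measurable W) {u : α → υ} (hu : Measurable u)
    {h : υ × β → γ} (hh : Measurable h) {k : υ × γ → β} (hk : Measurable k)
    (hkh : ∀ v w, k (v, h (v, w)) = w) (ρ : Measure β) [IsProbabilityMeasure ρ] :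
    (∀ᵐ ω ∂π, condDistrib (fun ω => h (u (P ω), W ω)) P π (P ω) = noiseKernel ρ h (u (P ω))) ↔
      π.map (fun ω => (P ω, W ω)) = (π.map P).prod ρ := by
  have hY : Measurable fun ω => h (u (P ω), W ω) := by fun_prop
  have hH : Measurable fun z : α × β => (z.1, h (u z.1, z.2)) := by fun_prop
  have hG : Measurable fun z : α × γ => (z.1, k (u z.1, z.2)) := by fun_prop
  have hGH : (fun z : α × γ => (z.1, k (u z.1, z.2))) ∘
      (fun z : α × β => (z.1, h (u z.1, z.2))) = id := by
    funext z; simp [hkh]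
  have h1 : π.map (fun ω => (P ω, h (u (P ω), W ω))) =
      (π.map fun ω => (P ω, W ω)).map fun z => (z.1, h (u z.1, z.2)) := by
    rw [Measure.map_map hH (by fun_prop)]; rfl
  have h2 : π.map P ⊗ₘ (noiseKernel ρ h).comap u hu =
      ((π.map P).prod ρ).map fun z => (z.1, h (u z.1, z.2)) := by
    ext s hs
    rw [Measure.compProd_apply hs, Measure.map_apply hH hs, Measure.prod_apply (hH hs)]
    refine lintegral_congr fun a => ?_
    rw [Kernel.comap_apply, noiseKernel_apply ρ hh,
      Measure.map_apply (by fun_prop) (measurable_prodMk_left hs)]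
    rfl
  have h3 := ae_condDistrib_eq_iff (π := π) hP hY ((noiseKernel ρ h).comap u hu)
  simp only [Kernel.comap_apply] at h3
  rw [h3, h1, h2]
  constructor
  · intro h
    have := congrArg (fun m => m.map fun z : α × γ => (z.1, k (u z.1, z.2))) h
    simpa only [Measure.map_map hG hH, hGH, Measure.map_id] using this
  · intro h
    rw [h]

end CondDistrib

/-! ### Gaussian paths and their noise -/

section Paths

variable {T d : ℕ}

/-- The matrix is lower triangular by blocks: time `p.1` depends only on times up to `p.1`. Unlike
lower triangularity, this is stable under orthogonal changes of basis within the time blocks. -/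
def IsBlockLower (L : Matrix (Fin T × Fin d) (Fin T × Fin d) ℝ) : Prop :=
  ∀ p q, p.1 < q.1 → L p q = 0

theorem IsBlockLower.inv {L : Matrix (Fin T × Fin d) (Fin T × Fin d) ℝ} (hL : IsBlockLower L)
    (hdet : IsUnit L.det) : IsBlockLower L⁻¹ := by
  have : Invertible L := L.invertibleOfIsUnitDet hdet
  have h : L.BlockTriangular fun p => OrderDual.toDual p.1 := fun p q hpq => hL p q hpq
  exact fun p q hpq => Matrix.blockTriangular_inv_of_blockTriangular h hpq

theorem IsBlockLower.mulVec_congr {L : Matrix (Fin T × Fin d) (Fin T × Fin d) ℝ}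
    (hL : IsBlockLower L) {g g' : Fin T × Fin d → ℝ} {p : Fin T × Fin d}
    (h : ∀ q, q.1 ≤ p.1 → g q = g' q) : (L *ᵥ g) p = (L *ᵥ g') p := by
  refine Finset.sum_congr rfl fun q _ => ?_
  rcases le_or_gt q.1 p.1 with hq | hq
  · rw [h q hq]
  · change L p q * g q = L p q * g' q
    rw [hL p q hq, zero_mul, zero_mul]

/-- The path `a + L g` driven by the noise `g`. -/
noncomputable def synth (L : Matrix (Fin T × Fin d) (Fin T × Fin d) ℝ) (a : PathSpace T d)
    (g : Fin T × Fin d → ℝ) : PathSpace T d :=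
  WithLp.toLp 2 (a.ofLp + L *ᵥ g)

/-- The noise `L⁻¹ (x - a)` that drives the path `x`; it inverts `synth` when `L` is invertible. -/
noncomputable def noise (L : Matrix (Fin T × Fin d) (Fin T × Fin d) ℝ) (a : PathSpace T d)
    (x : PathSpace T d) : Fin T × Fin d → ℝ :=
  L⁻¹ *ᵥ (x.ofLp - a.ofLp)

variable {L : Matrix (Fin T × Fin d) (Fin T × Fin d) ℝ} {a : PathSpace T d}

theorem noise_synth (hdet : IsUnit L.det) (g : Fin T × Fin d → ℝ) :
    noise L a (synth L a g) = g := by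
  simp [noise, synth, Matrix.nonsing_inv_mul _ hdet]

theorem synth_noise (hdet : IsUnit L.det) (x : PathSpace T d) :
    synth L a (noise L a x) = x := by
  simp [noise, synth, Matrix.mul_nonsing_inv _ hdet]

@[fun_prop]
theorem continuous_synth : Continuous (synth L a) := by
  unfold synth; fun_prop

@[fun_prop]
theorem continuous_noise : Continuous (noise L a) := by
  unfold noise; fun_prop

@[fun_prop]
theorem measurable_synth : Measurable (synth L a) := continuous_synth.measurable

@[fun_prop]
theorem measurable_noise : Measurable (noise L a) := continuous_noise.measurable

theorem synth_congr (hL : IsBlockLower L) {g g' : Fin T × Fin d → ℝ} {p : Fin T × Fin d}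
    (h : ∀ q, q.1 ≤ p.1 → g q = g' q) : synth L a g p = synth L a g' p := by
  change a p + (L *ᵥ g) p = a p + (L *ᵥ g') p
  rw [hL.mulVec_congr h]

theorem noise_congr (hL : IsBlockLower L) (hdet : IsUnit L.det) {x y : PathSpace T d}
    {p : Fin T × Fin d} (h : ∀ q, q.1 ≤ p.1 → x q = y q) : noise L a x p = noise L a y p :=
  (hL.inv hdet).mulVec_congr fun q hq => by
    change x q - a q = y q - a q
    rw [h q hq]

/-- White noise drives the Gaussian law: `a + L g` has law `N(a, L Lᵀ)` for every square root `L` of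
the covariance, not only the symmetric one in the definition of `multivariateGaussian`. -/
theorem map_synth (L : Matrix (Fin T × Fin d) (Fin T × Fin d) ℝ) (a : PathSpace T d) :
    (Measure.pi fun _ => gaussianReal 0 1).map (synth L a) =
      multivariateGaussian a (L * Lᵀ) := by
  have hps : (L * Lᵀ).PosSemidef := by
    simpa using Matrix.posSemidef_self_mul_conjTranspose L
  have h1 : (Measure.pi fun _ => gaussianReal 0 1).map (synth L a) =
      ((stdGaussian (PathSpace T d)).map (Matrix.toEuclideanCLM (𝕜 := ℝ) L)).map
        (fun x => a + x) := by
    rw [← map_pi_eq_stdGaussian, Measure.map_map (by fun_prop) (by fun_prop),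
      Measure.map_map (by fun_prop) (by fun_prop)]
    rfl
  rw [h1]
  have hint : Integrable (fun x => x)
      ((stdGaussian (PathSpace T d)).map (Matrix.toEuclideanCLM (𝕜 := ℝ) L)) :=
    IsGaussian.integrable_fun_id
  apply IsGaussian.ext
  · rw [integral_id_multivariateGaussian']
    simp only [id]
    rw [integral_map (by fun_prop) (by fun_prop), integral_add (integrable_const _) hint,
      ContinuousLinearMap.integral_id_map IsGaussian.integrable_id]
    simp
  · rw [covarianceBilin_map_const_add]
    ext x y
    rw [covarianceBilin_map IsGaussian.memLp_two_id, covarianceBilin_stdGaussian,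
      covarianceBilin_multivariateGaussian hps, innerSL_apply_apply,
      ContinuousLinearMap.adjoint_inner_left, ← ContinuousLinearMap.star_eq_adjoint, ← map_star,
      ← ContinuousLinearMap.comp_apply, ← ContinuousLinearMap.mul_def, ← map_mul,
      Matrix.inner_toEuclideanCLM]
    rfl

theorem map_noise (hdet : IsUnit L.det) :
    (multivariateGaussian a (L * Lᵀ)).map (noise L a) =
      Measure.pi fun _ => gaussianReal 0 1 := by
  rw [← map_synth, Measure.map_map measurable_noise measurable_synth]
  convert Measure.map_id
  funext g
  exact noise_synth hdet g

/-! ### Past, future and later noise -/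

/-- The path with the given first `t` time steps and the given remaining ones. -/
def joinPath (t : ℕ) (u : {s : Fin T // s.val < t} × Fin d → ℝ)
    (v : {s : Fin T // t ≤ s.val} × Fin d → ℝ) : PathSpace T d :=
  WithLp.toLp 2 fun p => if h : p.1.val < t then u (⟨p.1, h⟩, p.2) else
    v (⟨p.1, not_lt.1 h⟩, p.2)

theorem joinPath_of_lt {t : ℕ} (u : {s : Fin T // s.val < t} × Fin d → ℝ)
    (v : {s : Fin T // t ≤ s.val} × Fin d → ℝ) {p : Fin T × Fin d} (h : p.1.val < t) :
    joinPath t u v p = u (⟨p.1, h⟩, p.2) :=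
  dif_pos h

theorem joinPath_past_future (t : ℕ) (x : PathSpace T d) :
    joinPath t (past t x) (future t x) = x := by
  ext p
  by_cases h : p.1.val < t
  · exact dif_pos h
  · exact dif_neg h

@[fun_prop]
theorem measurable_past (t : ℕ) : Measurable (past (T := T) (d := d) t) := by
  unfold past; fun_prop

@[fun_prop]
theorem measurable_future (t : ℕ) : Measurable (future (T := T) (d := d) t) := by
  unfold future; fun_prop

@[fun_prop]
theorem measurable_joinPath (t : ℕ) :
    Measurable fun z : ({s : Fin T // s.val < t} × Fin d → ℝ) ×
      ({s : Fin T // t ≤ s.val} × Fin d → ℝ) => joinPath t z.1 z.2 := by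
  refine (WithLp.measurable_toLp 2 _).comp (measurable_pi_lambda _ fun p => ?_)
  by_cases h : p.1.val < t <;> simp only [h, dite_true, dite_false] <;> fun_prop

/-- The noise of `x` from the time step with index `t` on, that is, the part driving the future. -/
noncomputable def tailNoise (L : Matrix (Fin T × Fin d) (Fin T × Fin d) ℝ) (a : PathSpace T d) (t : ℕ)
    (x : PathSpace T d) : {p : Fin T × Fin d // t ≤ p.1.val} → ℝ :=
  fun p => noise L a x p

@[fun_prop]
theorem measurable_tailNoise (t : ℕ) : Measurable (tailNoise L a t) :=
  measurable_pi_lambda _ fun p => (measurable_pi_apply p.1).comp measurable_noise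

/-- The noise whose first `t` time steps are those of any path with past `z.1` and whose later time
steps are `z.2`. The past determines the early noise, so the path is completed by zero. -/
noncomputable def mixedNoise (L : Matrix (Fin T × Fin d) (Fin T × Fin d) ℝ) (a : PathSpace T d)
    (t : ℕ) (z : ({s : Fin T // s.val < t} × Fin d → ℝ) ×
      ({p : Fin T × Fin d // t ≤ p.1.val} → ℝ)) : Fin T × Fin d → ℝ :=
  fun p => if h : t ≤ p.1.val then z.2 ⟨p, h⟩ else noise L a (joinPath t z.1 0) p

@[fun_prop]
theorem measurable_mixedNoise (t : ℕ) : Measurable (mixedNoise L a t) := by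
  refine measurable_pi_lambda _ fun p => ?_
  unfold mixedNoise
  by_cases h : t ≤ p.1.val
  · simp only [h, dite_true]; fun_prop
  · simp only [h, dite_false]
    exact (measurable_pi_apply p).comp (measurable_noise.comp
      ((measurable_joinPath t).comp (measurable_fst.prodMk measurable_const)))

/-- The future of the path with past `z.1` that is driven by the later noise `z.2`. -/
noncomputable def noiseToFuture (L : Matrix (Fin T × Fin d) (Fin T × Fin d) ℝ) (a : PathSpace T d)
    (t : ℕ) (z : ({s : Fin T // s.val < t} × Fin d → ℝ) ×
      ({p : Fin T × Fin d // t ≤ p.1.val} → ℝ)) : {s : Fin T // t ≤ s.val} × Fin d → ℝ :=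
  future t (synth L a (mixedNoise L a t z))

@[fun_prop]
theorem measurable_noiseToFuture (t : ℕ) : Measurable (noiseToFuture L a t) := by
  unfold noiseToFuture; fun_prop

theorem noiseToFuture_tailNoise (hL : IsBlockLower L) (hdet : IsUnit L.det) (t : ℕ)
    (x : PathSpace T d) : noiseToFuture L a t (past t x, tailNoise L a t x) = future t x := by
  have h : mixedNoise L a t (past t x, tailNoise L a t x) = noise L a x := by
    funext p
    unfold mixedNoise
    split_ifs with h
    · rfl
    · refine noise_congr hL hdet fun q hq => ?_
      exact joinPath_of_lt _ _ (lt_of_le_of_lt hq (not_le.1 h))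
  rw [noiseToFuture, h, synth_noise hdet]

theorem past_synth_mixedNoise (hL : IsBlockLower L) (hdet : IsUnit L.det) (t : ℕ)
    (u : {s : Fin T // s.val < t} × Fin d → ℝ) (w : {p : Fin T × Fin d // t ≤ p.1.val} → ℝ) :
    past t (synth L a (mixedNoise L a t (u, w))) = u := by
  funext p
  have h : synth L a (mixedNoise L a t (u, w)) (p.1.1, p.2) =
      synth L a (noise L a (joinPath t u 0)) (p.1.1, p.2) := by
    refine synth_congr hL fun q hq => dif_neg (not_le.2 ?_)
    exact lt_of_le_of_lt (Fin.le_def.1 hq) p.1.2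
  change synth L a (mixedNoise L a t (u, w)) (p.1.1, p.2) = _
  rw [h, synth_noise hdet]
  exact joinPath_of_lt _ _ p.1.2

theorem tailNoise_joinPath_noiseToFuture (hL : IsBlockLower L) (hdet : IsUnit L.det) (t : ℕ)
    (u : {s : Fin T // s.val < t} × Fin d → ℝ) (w : {p : Fin T × Fin d // t ≤ p.1.val} → ℝ) :
    tailNoise L a t (joinPath t u (noiseToFuture L a t (u, w))) = w := by
  have h := joinPath_past_future t (synth L a (mixedNoise L a t (u, w)))
  rw [past_synth_mixedNoise hL hdet] at h
  rw [noiseToFuture, h]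
  funext p
  rw [tailNoise, noise_synth hdet]
  exact dif_pos p.2

theorem past_synth_congr (hL : IsBlockLower L) {t : ℕ} {g g' : Fin T × Fin d → ℝ}
    (h : ∀ q : Fin T × Fin d, q.1.val < t → g q = g' q) :
    past t (synth L a g) = past t (synth L a g') := by
  funext p
  exact synth_congr hL fun q hq => h q (lt_of_le_of_lt (Fin.le_def.1 hq) p.1.2)

/-! ### Bi-causality as independence of noise -/

/-- Functions of disjoint sets of coordinates are independent under a product measure. -/
theorem indepFun_pi_of_dependsOn {ι : Type*} [Fintype ι] [DecidableEq ι] {E : ι → Type*}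
    [∀ i, MeasurableSpace (E i)] [∀ i, Nonempty (E i)] (μ : ∀ i, Measure (E i))
    [∀ i, IsProbabilityMeasure (μ i)] {α β : Type*} [MeasurableSpace α] [MeasurableSpace β]
    {F : (∀ i, E i) → α} {G : (∀ i, E i) → β} (hF : Measurable F) (hG : Measurable G)
    {S S' : Finset ι} (hS : Disjoint S S') (hFS : DependsOn F (S : Set ι))
    (hGS : DependsOn G (S' : Set ι)) :
    IndepFun F G (Measure.pi μ) := by
  let w₀ : ∀ i, E i := fun i => Classical.arbitrary _
  let ext (R : Finset ι) (r : ∀ i : R, E i) : ∀ i, E i :=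
    fun i => if h : i ∈ R then r ⟨i, h⟩ else w₀ i
  have hext (R : Finset ι) : Measurable (ext R) := by
    refine measurable_pi_lambda _ fun i => ?_
    by_cases h : i ∈ R <;> simp only [ext, h, dite_true, dite_false] <;> fun_prop
  have hind := (iIndepFun_pi (X := fun i => (id : E i → E i)) (μ := μ)
    fun i => aemeasurable_id).indepFun_finset S S' hS fun i => measurable_pi_apply i
  have hFS' : F = (F ∘ ext S) ∘ fun w (i : S) => w i := by
    funext w
    refine hFS fun i hi => ?_
    simp only [ext, dif_pos (Finset.mem_coe.1 hi)]
  have hGS' : G = (G ∘ ext S') ∘ fun w (i : S') => w i := by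
    funext w
    refine hGS fun i hi => ?_
    simp only [ext, dif_pos (Finset.mem_coe.1 hi)]
  rw [hFS', hGS']
  exact hind.comp (hF.comp (hext S)) (hG.comp (hext S'))

variable {M : Matrix (Fin T × Fin d) (Fin T × Fin d) ℝ} {b : PathSpace T d}

theorem indepFun_past_tailNoise (hL : IsBlockLower L) (hdet : IsUnit L.det) (t : ℕ) :
    IndepFun (past t) (tailNoise L a t) (multivariateGaussian a (L * Lᵀ)) := by
  rw [← map_synth, indepFun_iff_map_prod_eq_prod_map_map (by fun_prop) (by fun_prop),
    Measure.map_map (by fun_prop) (by fun_prop), Measure.map_map (by fun_prop) (by fun_prop),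
    Measure.map_map (by fun_prop) (by fun_prop)]
  refine (indepFun_iff_map_prod_eq_prod_map_map (by fun_prop) (by fun_prop)).1
    (indepFun_pi_of_dependsOn _ (by fun_prop) (by fun_prop)
      (S := Finset.univ.filter fun p => p.1.val < t)
      (S' := Finset.univ.filter fun p => t ≤ p.1.val) ?_ ?_ ?_)
  · exact Finset.disjoint_filter.2 fun p _ h => not_le.2 h
  · exact fun g g' h => past_synth_congr hL fun q hq => h q (by simpa using hq)
  · intro g g' h
    funext p
    simp only [tailNoise, noise_synth hdet]
    exact h p (by simp)

theorem ae_pathKernel_eq (hL : IsBlockLower L) (hdet : IsUnit L.det) (t : ℕ) :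
    ∀ᵐ x ∂(multivariateGaussian a (L * Lᵀ)),
      pathKernel t (multivariateGaussian a (L * Lᵀ)) (past t x) =
        noiseKernel ((multivariateGaussian a (L * Lᵀ)).map (tailNoise L a t))
          (noiseToFuture L a t) (past t x) := by
  have : IsProbabilityMeasure ((multivariateGaussian a (L * Lᵀ)).map (tailNoise L a t)) :=
    Measure.isProbabilityMeasure_map (by fun_prop)
  have h := (ae_condDistrib_eq_noiseKernel_iff (π := multivariateGaussian a (L * Lᵀ))
    (P := past t) (W := tailNoise L a t) (measurable_past t) (measurable_tailNoise t) measurable_id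
    (measurable_noiseToFuture t)
    (k := fun z => tailNoise L a t (joinPath t z.1 z.2)) (by fun_prop)
    (tailNoise_joinPath_noiseToFuture hL hdet t)
    ((multivariateGaussian a (L * Lᵀ)).map (tailNoise L a t))).2
    ((indepFun_iff_map_prod_eq_prod_map_map (by fun_prop) (by fun_prop)).1
      (indepFun_past_tailNoise hL hdet t))
  simpa only [id, noiseToFuture_tailNoise hL hdet, pathKernel] using h

/-- Causality in terms of noise: enlarging the conditioning from the past of `X` to `P` leaves the
conditional law of the future of `X` unchanged exactly when the later noise of `X` is independent
of `P`. -/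
theorem ae_condDistrib_future_eq_iff (hL : IsBlockLower L) (hdet : IsUnit L.det) (t : ℕ)
    {Ω α : Type*} [MeasurableSpace Ω] [MeasurableSpace α] {π : Measure Ω}
    [IsProbabilityMeasure π] {X : Ω → PathSpace T d} (hX : Measurable X)
    (hlaw : π.map X = multivariateGaussian a (L * Lᵀ)) {P : Ω → α} (hP : Measurable P)
    {u : α → {s : Fin T // s.val < t} × Fin d → ℝ} (hu : Measurable u)
    (huP : ∀ ω, u (P ω) = past t (X ω)) :
    (∀ᵐ ω ∂π, condDistrib (fun ω => future t (X ω)) P π (P ω) =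
      pathKernel t (multivariateGaussian a (L * Lᵀ)) (past t (X ω))) ↔
    IndepFun P (fun ω => tailNoise L a t (X ω)) π := by
  have hprob : IsProbabilityMeasure ((multivariateGaussian a (L * Lᵀ)).map (tailNoise L a t)) :=
    Measure.isProbabilityMeasure_map (by fun_prop)
  have h := ae_condDistrib_eq_noiseKernel_iff (π := π)
    (P := P) (W := fun ω => tailNoise L a t (X ω)) hP (by fun_prop) hu
    (measurable_noiseToFuture t)
    (k := fun z => tailNoise L a t (joinPath t z.1 z.2)) (by fun_prop)
    (tailNoise_joinPath_noiseToFuture hL hdet t)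
    ((multivariateGaussian a (L * Lᵀ)).map (tailNoise L a t))
  simp only [huP, noiseToFuture_tailNoise hL hdet] at h
  rw [indepFun_iff_map_prod_eq_prod_map_map hP.aemeasurable (by fun_prop)]
  have h2 : π.map (fun ω => tailNoise L a t (X ω)) =
      (multivariateGaussian a (L * Lᵀ)).map (tailNoise L a t) := by
    rw [← hlaw, Measure.map_map (by fun_prop) hX]; rfl
  rw [h2, ← h]
  have h3 : ∀ᵐ ω ∂π, pathKernel t (multivariateGaussian a (L * Lᵀ)) (past t (X ω)) =
        noiseKernel ((multivariateGaussian a (L * Lᵀ)).map (tailNoise L a t))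
          (noiseToFuture L a t) (past t (X ω)) := by
    refine ae_of_ae_map (p := fun x => pathKernel t (multivariateGaussian a (L * Lᵀ)) (past t x) =
        noiseKernel ((multivariateGaussian a (L * Lᵀ)).map (tailNoise L a t))
          (noiseToFuture L a t) (past t x)) hX.aemeasurable ?_
    rw [hlaw]
    exact ae_pathKernel_eq hL hdet t
  refine eventually_congr ?_
  filter_upwards [h3] with ω hω
  rw [hω]

/-- A coupling is bi-causal exactly when, at each time, the later noise of either path is
independent of the pair of pasts. -/
theorem isBicausalCoupling_iff (hL : IsBlockLower L) (hdetL : IsUnit L.det)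
    (hM : IsBlockLower M) (hdetM : IsUnit M.det)
    (π : Measure (PathSpace T d × PathSpace T d)) [IsProbabilityMeasure π] :
    IsBicausalCoupling (multivariateGaussian a (L * Lᵀ)) (multivariateGaussian b (M * Mᵀ)) π ↔
      IsCoupling (multivariateGaussian a (L * Lᵀ)) (multivariateGaussian b (M * Mᵀ)) π ∧
        ∀ t : ℕ, 1 ≤ t → t < T →
          IndepFun (fun z => (past t z.1, past t z.2)) (fun z => tailNoise L a t z.1) π ∧
          IndepFun (fun z => (past t z.1, past t z.2)) (fun z => tailNoise M b t z.2) π := by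
  unfold IsBicausalCoupling
  refine and_congr_right fun hc => forall_congr' fun t => forall_congr' fun _ =>
    forall_congr' fun _ => ?_
  rw [← ae_condDistrib_future_eq_iff hL hdetL t measurable_fst hc.1
      (P := fun z => (past t z.1, past t z.2)) (u := Prod.fst) (by fun_prop) measurable_fst
      fun _ => rfl,
    ← ae_condDistrib_future_eq_iff hM hdetM t measurable_snd hc.2
      (P := fun z => (past t z.1, past t z.2)) (u := Prod.snd) (by fun_prop) measurable_snd
      fun _ => rfl, ← eventually_and]
  have hY : Measurable fun z : PathSpace T d × PathSpace T d => (future t z.1, future t z.2) := by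
    fun_prop
  have hP : Measurable fun z : PathSpace T d × PathSpace T d => (past t z.1, past t z.2) := by
    fun_prop
  have h1 := ae_of_ae_map hP.aemeasurable (condDistrib_comp (μ := π)
    (fun z : PathSpace T d × PathSpace T d => (past t z.1, past t z.2)) hY.aemeasurable
    measurable_fst)
  have h2 := ae_of_ae_map hP.aemeasurable (condDistrib_comp (μ := π)
    (fun z : PathSpace T d × PathSpace T d => (past t z.1, past t z.2)) hY.aemeasurable
    measurable_snd)
  refine eventually_congr ?_
  filter_upwards [h1, h2] with z hz1 hz2
  rw [Kernel.map_apply _ measurable_fst] at hz1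
  rw [Kernel.map_apply _ measurable_snd] at hz2
  unfold IsCoupling pairKernel
  rw [← hz1, ← hz2]
  rfl

variable {π : Measure (PathSpace T d × PathSpace T d)}

/-! ### The transport cost -/

theorem map_noise_apply (hdet : IsUnit L.det) (p : Fin T × Fin d) :
    (multivariateGaussian a (L * Lᵀ)).map (fun x => noise L a x p) = gaussianReal 0 1 := by
  have h := (measurePreserving_eval (fun _ : Fin T × Fin d => gaussianReal 0 1) p).map_eq
  rw [← map_noise (a := a) hdet, Measure.map_map (by fun_prop) (by fun_prop)] at h
  exact h

theorem IsCoupling.map_noise_fst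
    (hπ : IsCoupling (multivariateGaussian a (L * Lᵀ)) (multivariateGaussian b (M * Mᵀ)) π)
    (hdet : IsUnit L.det) (p : Fin T × Fin d) :
    π.map (fun z => noise L a z.1 p) = gaussianReal 0 1 := by
  rw [← map_noise_apply (a := a) hdet p, ← hπ.1, Measure.map_map (by fun_prop) (by fun_prop)]
  rfl

theorem IsCoupling.map_noise_snd
    (hπ : IsCoupling (multivariateGaussian a (L * Lᵀ)) (multivariateGaussian b (M * Mᵀ)) π)
    (hdet : IsUnit M.det) (p : Fin T × Fin d) :
    π.map (fun z => noise M b z.2 p) = gaussianReal 0 1 := by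
  rw [← map_noise_apply (a := b) hdet p, ← hπ.2, Measure.map_map (by fun_prop) (by fun_prop)]
  rfl

theorem IsCoupling.memLp_noise_fst
    (hπ : IsCoupling (multivariateGaussian a (L * Lᵀ)) (multivariateGaussian b (M * Mᵀ)) π)
    (hdet : IsUnit L.det) (p : Fin T × Fin d) : MemLp (fun z => noise L a z.1 p) 2 π :=
  memLp_of_map_eq_gaussianReal (by fun_prop) (hπ.map_noise_fst hdet p)

theorem IsCoupling.memLp_noise_snd
    (hπ : IsCoupling (multivariateGaussian a (L * Lᵀ)) (multivariateGaussian b (M * Mᵀ)) π)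
    (hdet : IsUnit M.det) (p : Fin T × Fin d) : MemLp (fun z => noise M b z.2 p) 2 π :=
  memLp_of_map_eq_gaussianReal (by fun_prop) (hπ.map_noise_snd hdet p)

theorem IsCoupling.integrable_noise_mul_noise
    (hπ : IsCoupling (multivariateGaussian a (L * Lᵀ)) (multivariateGaussian b (M * Mᵀ)) π)
    (hL : IsUnit L.det) (hM : IsUnit M.det) (p q : Fin T × Fin d) :
    Integrable (fun z => noise L a z.1 p * noise M b z.2 q) π :=
  (hπ.memLp_noise_fst hL p).integrable_mul (hπ.memLp_noise_snd hM q)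

theorem integral_eval_multivariateGaussian {A : Matrix (Fin T × Fin d) (Fin T × Fin d) ℝ}
    (hA : A.PosSemidef) (r : Fin T × Fin d) : ∫ x, x r ∂(multivariateGaussian a A) = a r := by
  have h := measurePreserving_eval_multivariateGaussian (μ := a) hA (i := r)
  have h2 := integral_map (μ := multivariateGaussian a A) (φ := fun x => x r) (f := fun y : ℝ => y)
    (by fun_prop) (by fun_prop)
  rw [← h2, h.map_eq, integral_id_gaussianReal]

theorem integral_sq_sub_multivariateGaussian {A : Matrix (Fin T × Fin d) (Fin T × Fin d) ℝ}
    (hA : A.PosSemidef) (r : Fin T × Fin d) :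
    ∫ x, (x r - a r) ^ 2 ∂(multivariateGaussian a A) = A r r := by
  rw [← variance_eval_multivariateGaussian (μ := a) hA r, variance_eq_integral (by fun_prop),
    integral_eval_multivariateGaussian hA]

theorem memLp_eval_multivariateGaussian {A : Matrix (Fin T × Fin d) (Fin T × Fin d) ℝ}
    (hA : A.PosSemidef) (r : Fin T × Fin d) :
    MemLp (fun x => x r - a r) 2 (multivariateGaussian a A) := by
  have h := measurePreserving_eval_multivariateGaussian (μ := a) hA (i := r)
  exact ((memLp_id_gaussianReal 2).comp_measurePreserving h).sub (memLp_const _)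

theorem integral_sub_multivariateGaussian {A : Matrix (Fin T × Fin d) (Fin T × Fin d) ℝ}
    (hA : A.PosSemidef) (r : Fin T × Fin d) :
    ∫ x, (x r - a r) ∂(multivariateGaussian a A) = 0 := by
  have h := ((memLp_eval_multivariateGaussian (a := a) hA r).integrable one_le_two).add
    (integrable_const (a r))
  have h' : Integrable (fun x : PathSpace T d => x r) (multivariateGaussian a A) := by
    simpa [Pi.add_def] using h
  rw [integral_sub h' (integrable_const _), integral_eval_multivariateGaussian hA]
  simp

theorem integral_sq_sub_add {Ω : Type*} [MeasurableSpace Ω] {P : Measure Ω}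
    [IsProbabilityMeasure P] {U V : Ω → ℝ} (hU : MemLp U 2 P) (hV : MemLp V 2 P)
    (eU : ∫ ω, U ω ∂P = 0) (eV : ∫ ω, V ω ∂P = 0) (c : ℝ) :
    Integrable (fun ω => (U ω - V ω + c) ^ 2) P ∧
    ∫ ω, (U ω - V ω + c) ^ 2 ∂P =
      c ^ 2 + (∫ ω, U ω ^ 2 ∂P + ∫ ω, V ω ^ 2 ∂P) - 2 * ∫ ω, U ω * V ω ∂P := by
  have hU1 := hU.integrable one_le_two
  have hV1 := hV.integrable one_le_two
  have hUV : Integrable (fun ω => U ω * V ω) P := hU.integrable_mul hV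
  have hexp : (fun ω => (U ω - V ω + c) ^ 2) = fun ω =>
      (U ω ^ 2 + V ω ^ 2 - 2 * (U ω * V ω)) + (2 * c * (U ω - V ω) + c ^ 2) := by
    funext z; ring
  have i1 : Integrable (fun ω => U ω ^ 2 + V ω ^ 2) P := hU.integrable_sq.add hV.integrable_sq
  have i2 : Integrable (fun ω => 2 * (U ω * V ω)) P := hUV.const_mul 2
  have i12 : Integrable (fun ω => U ω ^ 2 + V ω ^ 2 - 2 * (U ω * V ω)) P := i1.sub i2
  have i3 : Integrable (fun ω => 2 * c * (U ω - V ω)) P := (hU1.sub hV1).const_mul (2 * c)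
  have i34 : Integrable (fun ω => 2 * c * (U ω - V ω) + c ^ 2) P := i3.add (integrable_const _)
  rw [hexp]
  refine ⟨i12.add i34, ?_⟩
  rw [integral_add i12 i34, integral_sub i1 i2, integral_add hU.integrable_sq hV.integrable_sq,
    integral_add i3 (integrable_const _), integral_const_mul, integral_const_mul,
    integral_sub hU1 hV1, eU, eV]
  simp
  ring

theorem posSemidef_mul_transpose (L : Matrix (Fin T × Fin d) (Fin T × Fin d) ℝ) :
    (L * Lᵀ).PosSemidef := by
  simpa using Matrix.posSemidef_self_mul_conjTranspose L

theorem sub_eq_sum_noise (hdet : IsUnit L.det) (x : PathSpace T d) (r : Fin T × Fin d) :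
    x r - a r = ∑ p, L r p * noise L a x p := by
  have h := congrArg (fun y : PathSpace T d => y r - a r) (synth_noise (a := a) hdet x)
  simp only at h
  rw [← h]
  change a r + (L *ᵥ noise L a x) r - a r = _
  rw [add_sub_cancel_left]
  rfl

theorem IsCoupling.integral_sub_mul_sub
    (hπ : IsCoupling (multivariateGaussian a (L * Lᵀ)) (multivariateGaussian b (M * Mᵀ)) π)
    (hL : IsUnit L.det) (hM : IsUnit M.det) (r : Fin T × Fin d) :
    ∫ z, (z.1 r - a r) * (z.2 r - b r) ∂π =
      ∑ p, ∑ q, L r p * M r q * ∫ z, noise L a z.1 p * noise M b z.2 q ∂π := by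
  have hint := hπ.integrable_noise_mul_noise hL hM
  have h : ∀ z : PathSpace T d × PathSpace T d, (z.1 r - a r) * (z.2 r - b r) =
      ∑ p, ∑ q, L r p * M r q * (noise L a z.1 p * noise M b z.2 q) := by
    intro z
    rw [sub_eq_sum_noise hL, sub_eq_sum_noise hM, Finset.sum_mul_sum]
    exact Finset.sum_congr rfl fun p _ => Finset.sum_congr rfl fun q _ => by ring
  simp_rw [h]
  rw [integral_finsetSum _ fun p _ => integrable_finsetSum _ fun q _ => (hint p q).const_mul _]
  refine Finset.sum_congr rfl fun p _ => ?_
  rw [integral_finsetSum _ fun q _ => (hint p q).const_mul _]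
  exact Finset.sum_congr rfl fun q _ => integral_const_mul _ _

theorem IsCoupling.integral_sq_coord
    (hπ : IsCoupling (multivariateGaussian a (L * Lᵀ)) (multivariateGaussian b (M * Mᵀ)) π)
    [IsProbabilityMeasure π]
    (hL : IsUnit L.det) (hM : IsUnit M.det) (r : Fin T × Fin d) :
    Integrable (fun z => (z.1 r - z.2 r) ^ 2) π ∧
    ∫ z, (z.1 r - z.2 r) ^ 2 ∂π = (a r - b r) ^ 2 + ((L * Lᵀ) r r + (M * Mᵀ) r r) -
      2 * ∑ p, ∑ q, L r p * M r q * ∫ z, noise L a z.1 p * noise M b z.2 q ∂π := by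
  rw [← hπ.integral_sub_mul_sub hL hM]
  have hA := posSemidef_mul_transpose L
  have hB := posSemidef_mul_transpose M
  have hU : MemLp (fun z : PathSpace T d × PathSpace T d => z.1 r - a r) 2 π :=
    (memLp_eval_multivariateGaussian hA r).comp_measurePreserving ⟨measurable_fst, hπ.1⟩
  have hV : MemLp (fun z : PathSpace T d × PathSpace T d => z.2 r - b r) 2 π :=
    (memLp_eval_multivariateGaussian hB r).comp_measurePreserving ⟨measurable_snd, hπ.2⟩
  have eU1 : ∫ z, (z.1 r - a r) ∂π = 0 := by
    rw [← integral_sub_multivariateGaussian (a := a) hA r, ← hπ.1,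
      integral_map (by fun_prop) (by fun_prop)]
  have eV1 : ∫ z, (z.2 r - b r) ∂π = 0 := by
    rw [← integral_sub_multivariateGaussian (a := b) hB r, ← hπ.2,
      integral_map (by fun_prop) (by fun_prop)]
  have eU2 : ∫ z, (z.1 r - a r) ^ 2 ∂π = (L * Lᵀ) r r := by
    rw [← integral_sq_sub_multivariateGaussian (a := a) hA, ← hπ.1,
      integral_map (by fun_prop) (by fun_prop)]
  have eV2 : ∫ z, (z.2 r - b r) ^ 2 ∂π = (M * Mᵀ) r r := by
    rw [← integral_sq_sub_multivariateGaussian (a := b) hB, ← hπ.2,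
      integral_map (by fun_prop) (by fun_prop)]
  have h := integral_sq_sub_add hU hV eU1 eV1 (a r - b r)
  rw [eU2, eV2] at h
  have hz : ∀ z : PathSpace T d × PathSpace T d,
      z.1 r - a r - (z.2 r - b r) + (a r - b r) = z.1 r - z.2 r := fun z => by ring
  simpa only [hz] using h

theorem IsCoupling.integral_norm_sq
    (hπ : IsCoupling (multivariateGaussian a (L * Lᵀ)) (multivariateGaussian b (M * Mᵀ)) π)
    [IsProbabilityMeasure π]
    (hL : IsUnit L.det) (hM : IsUnit M.det) :
    Integrable (fun z => ‖z.1 - z.2‖ ^ 2) π ∧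
    ∫ z, ‖z.1 - z.2‖ ^ 2 ∂π = ‖a - b‖ ^ 2 + (L * Lᵀ + M * Mᵀ).trace -
      2 * ∑ p, ∑ q, (Mᵀ * L) q p * ∫ z, noise L a z.1 p * noise M b z.2 q ∂π := by
  have h1 : ∀ x y : PathSpace T d, ‖x - y‖ ^ 2 = ∑ r, (x r - y r) ^ 2 := fun x y => by
    rw [EuclideanSpace.real_norm_sq_eq]; rfl
  simp_rw [h1]
  have h := hπ.integral_sq_coord hL hM
  refine ⟨integrable_finsetSum _ fun r _ => (h r).1, ?_⟩
  rw [integral_finsetSum _ fun r _ => (h r).1, Finset.sum_congr rfl fun r _ => (h r).2,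
    Finset.sum_sub_distrib, Finset.sum_add_distrib, ← Finset.mul_sum]
  congr 2
  rw [Finset.sum_comm]
  refine Finset.sum_congr rfl fun p _ => ?_
  rw [Finset.sum_comm]
  refine Finset.sum_congr rfl fun q _ => ?_
  rw [← Finset.sum_mul, Matrix.mul_apply]
  congr 1
  exact Finset.sum_congr rfl fun r _ => mul_comm _ _

theorem noise_joinPath_past (hL : IsBlockLower L) (hdet : IsUnit L.det) {t : ℕ}
    (x : PathSpace T d) (v : {s : Fin T // t ≤ s.val} × Fin d → ℝ) {p : Fin T × Fin d}
    (hp : p.1.val < t) : noise L a (joinPath t (past t x) v) p = noise L a x p :=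
  noise_congr hL hdet fun _ hs => joinPath_of_lt _ _ (lt_of_le_of_lt (Fin.le_def.1 hs) hp)

theorem measurable_noise_joinPath (t : ℕ) (p : Fin T × Fin d) :
    Measurable fun u => noise L a (joinPath t u 0) p :=
  (measurable_pi_apply p).comp (measurable_noise.comp
    ((measurable_joinPath t).comp (measurable_id.prodMk measurable_const)))

/-- Under a bi-causal coupling, noises at different times are uncorrelated: the later one is
independent of the pair of pasts, which determines the earlier one. -/
theorem integral_noise_mul_noise_of_ne (hL : IsBlockLower L) (hdetL : IsUnit L.det)
    (hM : IsBlockLower M) (hdetM : IsUnit M.det) [IsProbabilityMeasure π]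
    (hπ : IsBicausalCoupling (multivariateGaussian a (L * Lᵀ))
      (multivariateGaussian b (M * Mᵀ)) π) {p q : Fin T × Fin d} (hpq : p.1 ≠ q.1) :
    ∫ z, noise L a z.1 p * noise M b z.2 q ∂π = 0 := by
  rw [isBicausalCoupling_iff hL hdetL hM hdetM] at hπ
  obtain ⟨hc, hind⟩ := hπ
  have e1 : ∫ z, noise L a z.1 p ∂π = 0 := by
    have h := integral_map (μ := π) (φ := fun z => noise L a z.1 p) (f := fun y : ℝ => y)
      (by fun_prop) (by fun_prop)
    rw [← h, hc.map_noise_fst hdetL, integral_id_gaussianReal]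
  have e2 : ∫ z, noise M b z.2 q ∂π = 0 := by
    have h := integral_map (μ := π) (φ := fun z => noise M b z.2 q) (f := fun y : ℝ => y)
      (by fun_prop) (by fun_prop)
    rw [← h, hc.map_noise_snd hdetM, integral_id_gaussianReal]
  have key : IndepFun (fun z => noise L a z.1 p) (fun z => noise M b z.2 q) π := by
    rcases lt_or_gt_of_ne hpq with h | h
    · have hi := (hind q.1.val (by have := Fin.lt_def.1 h; omega) q.1.2).2
      have hc := hi.comp ((measurable_noise_joinPath (L := L) (a := a) q.1.val p).comp
        measurable_fst) (measurable_pi_apply (⟨q, le_rfl⟩ : {p : Fin T × Fin d // q.1.val ≤ p.1.val}))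
      refine hc.congr (ae_of_all _ fun z => ?_) (ae_of_all _ fun z => rfl)
      exact noise_joinPath_past hL hdetL z.1 0 (Fin.lt_def.1 h)
    · have hi := (hind p.1.val (by have := Fin.lt_def.1 h; omega) p.1.2).1
      have hc := hi.comp ((measurable_noise_joinPath (L := M) (a := b) p.1.val q).comp
        measurable_snd) (measurable_pi_apply (⟨p, le_rfl⟩ : {q : Fin T × Fin d // p.1.val ≤ q.1.val}))
      refine (hc.congr (ae_of_all _ fun z => ?_) (ae_of_all _ fun z => rfl)).symm
      exact noise_joinPath_past hM hdetM z.2 0 (Fin.lt_def.1 h)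
  have := key.integral_mul_eq_mul_integral (by fun_prop) (by fun_prop)
  rw [e1, zero_mul] at this
  exact this

/-- When the diagonal blocks of `Mᵀ L` are diagonal, the transport cost of a bi-causal coupling
depends on it only through the correlations of the noises with equal index. -/
theorem IsBicausalCoupling.lintegral_norm_sq (hL : IsBlockLower L) (hdetL : IsUnit L.det)
    (hM : IsBlockLower M) (hdetM : IsUnit M.det) [IsProbabilityMeasure π]
    (hdiag : ∀ p q : Fin T × Fin d, p.1 = q.1 → p ≠ q → (Mᵀ * L) p q = 0)
    (hπ : IsBicausalCoupling (multivariateGaussian a (L * Lᵀ))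
      (multivariateGaussian b (M * Mᵀ)) π) :
    0 ≤ ‖a - b‖ ^ 2 + (L * Lᵀ + M * Mᵀ).trace -
      2 * ∑ p, (Mᵀ * L) p p * ∫ z, noise L a z.1 p * noise M b z.2 p ∂π ∧
    ∫⁻ z, ENNReal.ofReal (‖z.1 - z.2‖ ^ 2) ∂π =
      ENNReal.ofReal (‖a - b‖ ^ 2 + (L * Lᵀ + M * Mᵀ).trace -
      2 * ∑ p, (Mᵀ * L) p p * ∫ z, noise L a z.1 p * noise M b z.2 p ∂π) := by
  obtain ⟨h1, h2⟩ := hπ.1.integral_norm_sq hdetL hdetM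
  have h3 : ∀ p, ∑ q, (Mᵀ * L) q p * ∫ z, noise L a z.1 p * noise M b z.2 q ∂π =
      (Mᵀ * L) p p * ∫ z, noise L a z.1 p * noise M b z.2 p ∂π := by
    intro p
    refine Finset.sum_eq_single p (fun q _ hqp => ?_) (by simp)
    by_cases h : q.1 = p.1
    · rw [hdiag q p h hqp, zero_mul]
    · rw [integral_noise_mul_noise_of_ne hL hdetL hM hdetM hπ (Ne.symm h), mul_zero]
  rw [Finset.sum_congr rfl fun p _ => h3 p] at h2
  rw [← h2]
  exact ⟨integral_nonneg fun z => by positivity,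
    (ofReal_integral_eq_lintegral_ofReal h1 (ae_of_all _ fun z => by positivity)).symm⟩

/-! ### The Gaussian couplings and their entropy -/

/-- The pair of paths driven by a noise with values in `ℝ × ℝ`. -/
noncomputable def pairSynth (L M : Matrix (Fin T × Fin d) (Fin T × Fin d) ℝ) (a b : PathSpace T d)
    (w : Fin T × Fin d → ℝ × ℝ) : PathSpace T d × PathSpace T d :=
  (synth L a fun p => (w p).1, synth M b fun p => (w p).2)

@[fun_prop]
theorem measurable_pairSynth : Measurable (pairSynth L M a b) := by
  unfold pairSynth; fun_prop

theorem map_pairSynth (L M : Matrix (Fin T × Fin d) (Fin T × Fin d) ℝ) (a b : PathSpace T d) :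
    (Measure.pi fun _ : Fin T × Fin d => (gaussianReal 0 1).prod (gaussianReal 0 1)).map
      (pairSynth L M a b) =
      (multivariateGaussian a (L * Lᵀ)).prod (multivariateGaussian b (M * Mᵀ)) := by
  have h := (measurePreserving_arrowProdEquivProdArrow ℝ ℝ (Fin T × Fin d)
    (fun _ => gaussianReal 0 1) (fun _ => gaussianReal 0 1)).map_eq
  rw [← map_synth, ← map_synth, Measure.map_prod_map _ _ measurable_synth measurable_synth, ← h,
    Measure.map_map (by fun_prop) (by fun_prop)]
  rfl

/-- The logarithm of the density of `corrCoupling` with respect to the product of its marginals. -/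
noncomputable def logDensity (L M : Matrix (Fin T × Fin d) (Fin T × Fin d) ℝ) (a b : PathSpace T d)
    (ρ : Fin T × Fin d → ℝ) (z : PathSpace T d × PathSpace T d) : ℝ :=
  ∑ p, corrLogDensity (ρ p) (noise L a z.1 p, noise M b z.2 p)

theorem measurable_logDensity (ρ : Fin T × Fin d → ℝ) :
    Measurable (logDensity L M a b ρ) := by
  unfold logDensity; fun_prop

/-- The Gaussian coupling in which the noises with index `p` have correlation `ρ p` and are
independent over `p`. -/
noncomputable def corrCoupling (L M : Matrix (Fin T × Fin d) (Fin T × Fin d) ℝ)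
    (a b : PathSpace T d) (ρ : Fin T × Fin d → ℝ) : Measure (PathSpace T d × PathSpace T d) :=
  (Measure.pi fun p => corrGaussian (ρ p)).map (pairSynth L M a b)

section

variable {ρ : Fin T × Fin d → ℝ}

theorem isProbabilityMeasure_corrCoupling (hρ : ∀ p, ρ p ^ 2 < 1) :
    IsProbabilityMeasure (corrCoupling L M a b ρ) := by
  have : ∀ p, IsProbabilityMeasure (corrGaussian (ρ p)) := fun p =>
    isProbabilityMeasure_corrGaussian (hρ p)
  exact Measure.isProbabilityMeasure_map (by fun_prop)

theorem corrCoupling_eq_withDensity (hL : IsUnit L.det) (hM : IsUnit M.det)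
    (hρ : ∀ p, ρ p ^ 2 < 1) :
    corrCoupling L M a b ρ =
      ((multivariateGaussian a (L * Lᵀ)).prod (multivariateGaussian b (M * Mᵀ))).withDensity
        fun z => ENNReal.ofReal (Real.exp (logDensity L M a b ρ z)) := by
  have hprob : ∀ p, IsProbabilityMeasure (((gaussianReal 0 1).prod (gaussianReal 0 1)).withDensity
      fun z => ENNReal.ofReal (Real.exp (corrLogDensity (ρ p) z))) := fun p =>
    isProbabilityMeasure_corrGaussian (hρ p)
  have hm := measurable_logDensity (L := L) (M := M) (a := a) (b := b) ρ
  rw [← map_pairSynth, ← map_withDensity_comp _ measurable_pairSynth (by fun_prop), corrCoupling]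
  congr 1
  refine (pi_withDensity (fun _ => (gaussianReal 0 1).prod (gaussianReal 0 1)) _
    fun p => by fun_prop).trans ?_
  congr 1
  funext w
  rw [← ENNReal.ofReal_prod_of_nonneg fun p _ => (Real.exp_pos _).le, ← Real.exp_sum]
  simp only [Function.comp, logDensity, pairSynth, noise_synth hL, noise_synth hM]

theorem isCoupling_corrCoupling (hρ : ∀ p, ρ p ^ 2 < 1) :
    IsCoupling (multivariateGaussian a (L * Lᵀ)) (multivariateGaussian b (M * Mᵀ))
      (corrCoupling L M a b ρ) := by
  have : ∀ p, IsProbabilityMeasure (corrGaussian (ρ p)) := fun p =>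
    isProbabilityMeasure_corrGaussian (hρ p)
  have h1 := Measure.pi_map_pi (μ := fun p => corrGaussian (ρ p))
    (f := fun _ => (Prod.fst : ℝ × ℝ → ℝ)) fun _ => measurable_fst.aemeasurable
  have h2 := Measure.pi_map_pi (μ := fun p => corrGaussian (ρ p))
    (f := fun _ => (Prod.snd : ℝ × ℝ → ℝ)) fun _ => measurable_snd.aemeasurable
  simp only [corrGaussian_map_fst (hρ _)] at h1
  simp only [corrGaussian_map_snd (hρ _)] at h2
  constructor
  · rw [corrCoupling, Measure.map_map measurable_fst (by fun_prop), ← map_synth, ← h1,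
      Measure.map_map (by fun_prop) (by fun_prop)]
    rfl
  · rw [corrCoupling, Measure.map_map measurable_snd (by fun_prop), ← map_synth, ← h2,
      Measure.map_map (by fun_prop) (by fun_prop)]
    rfl

theorem isBicausalCoupling_corrCoupling (hL : IsBlockLower L) (hdetL : IsUnit L.det)
    (hM : IsBlockLower M) (hdetM : IsUnit M.det) (hρ : ∀ p, ρ p ^ 2 < 1)
    [IsProbabilityMeasure (corrCoupling L M a b ρ)] :
    IsBicausalCoupling (multivariateGaussian a (L * Lᵀ)) (multivariateGaussian b (M * Mᵀ))
      (corrCoupling L M a b ρ) := by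
  rw [isBicausalCoupling_iff hL hdetL hM hdetM]
  refine ⟨isCoupling_corrCoupling hρ, fun t _ _ => ?_⟩
  have hp : ∀ p, IsProbabilityMeasure (corrGaussian (ρ p)) := fun p =>
    isProbabilityMeasure_corrGaussian (hρ p)
  have hdisj : Disjoint (Finset.univ.filter fun p : Fin T × Fin d => p.1.val < t)
      (Finset.univ.filter fun p : Fin T × Fin d => t ≤ p.1.val) :=
    Finset.disjoint_filter.2 fun p _ h => not_le.2 h
  have hpast : DependsOn ((fun z => (past t z.1, past t z.2)) ∘ pairSynth L M a b)
      ((Finset.univ.filter fun p : Fin T × Fin d => p.1.val < t : Finset _) : Set _) := by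
    intro w w' h
    have h' : ∀ q : Fin T × Fin d, q.1.val < t → w q = w' q := fun q hq => h q (by simpa using hq)
    exact Prod.ext (past_synth_congr hL fun q hq => by rw [h' q hq])
      (past_synth_congr hM fun q hq => by rw [h' q hq])
  have hmap : ∀ {β : Type} [MeasurableSpace β] {G : PathSpace T d × PathSpace T d → β},
      Measurable G → DependsOn (G ∘ pairSynth L M a b)
        ((Finset.univ.filter fun p : Fin T × Fin d => t ≤ p.1.val : Finset _) : Set _) →
      IndepFun (fun z => (past t z.1, past t z.2)) G (corrCoupling L M a b ρ) := by
    intro β _ G hG hdep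
    have h := (indepFun_iff_map_prod_eq_prod_map_map (by fun_prop) (by fun_prop)).1
      (indepFun_pi_of_dependsOn (fun p => corrGaussian (ρ p)) (by fun_prop) (by fun_prop) hdisj
        hpast hdep)
    rw [indepFun_iff_map_prod_eq_prod_map_map (by fun_prop) (by fun_prop), corrCoupling,
      Measure.map_map (by fun_prop) (by fun_prop), Measure.map_map (by fun_prop) (by fun_prop),
      Measure.map_map (by fun_prop) (by fun_prop)]
    exact h
  refine ⟨hmap (by fun_prop) ?_, hmap (by fun_prop) ?_⟩
  · intro w w' h
    funext p
    simp only [Function.comp, tailNoise, pairSynth, noise_synth hdetL]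
    rw [h p (by simp)]
  · intro w w' h
    funext p
    simp only [Function.comp, tailNoise, pairSynth, noise_synth hdetM]
    rw [h p (by simp)]

theorem integral_noise_mul_noise_corrCoupling (hL : IsUnit L.det) (hM : IsUnit M.det)
    (hρ : ∀ p, ρ p ^ 2 < 1) (p : Fin T × Fin d) :
    ∫ z, noise L a z.1 p * noise M b z.2 p ∂(corrCoupling L M a b ρ) = ρ p := by
  have hp : ∀ p, IsProbabilityMeasure (corrGaussian (ρ p)) := fun p =>
    isProbabilityMeasure_corrGaussian (hρ p)
  rw [corrCoupling, integral_map (by fun_prop) (by fun_prop)]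
  simp only [pairSynth, noise_synth hL, noise_synth hM]
  rw [← integral_mul_corrGaussian (hρ p)]
  conv_rhs => rw [← (measurePreserving_eval (fun p => corrGaussian (ρ p)) p).map_eq]
  rw [integral_map (measurable_pi_apply p).aemeasurable (by fun_prop)]

/-- The integral of `logDensity` under any coupling of the two Gaussian laws; the marginals fix all
terms but the correlations. -/
theorem IsCoupling.integral_logDensity [IsProbabilityMeasure π]
    (hπ : IsCoupling (multivariateGaussian a (L * Lᵀ)) (multivariateGaussian b (M * Mᵀ)) π)
    (hL : IsUnit L.det) (hM : IsUnit M.det) (ρ : Fin T × Fin d → ℝ) :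
    Integrable (logDensity L M a b ρ) π ∧
    ∫ z, logDensity L M a b ρ z ∂π = ∑ p, (-(Real.log (1 - ρ p ^ 2)) / 2 -
      (2 * ρ p ^ 2 - 2 * ρ p * ∫ z, noise L a z.1 p * noise M b z.2 p ∂π) /
        (2 * (1 - ρ p ^ 2))) := by
  have key : ∀ p, Integrable
      (fun z => corrLogDensity (ρ p) (noise L a z.1 p, noise M b z.2 p)) π ∧
      ∫ z, corrLogDensity (ρ p) (noise L a z.1 p, noise M b z.2 p) ∂π =
      (-(Real.log (1 - ρ p ^ 2)) / 2 -
      (2 * ρ p ^ 2 - 2 * ρ p * ∫ z, noise L a z.1 p * noise M b z.2 p ∂π) /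
        (2 * (1 - ρ p ^ 2))) := by
    intro p
    have i1 := (hπ.memLp_noise_fst hL p).integrable_sq
    have i2 := (hπ.memLp_noise_snd hM p).integrable_sq
    have i3 := hπ.integrable_noise_mul_noise hL hM p p
    have i12 : Integrable (fun z => ρ p ^ 2 * (noise L a z.1 p ^ 2 + noise M b z.2 p ^ 2)) π :=
      (i1.add i2).const_mul _
    have i33 := i3.const_mul (2 * ρ p)
    have i4 : Integrable (fun z => (ρ p ^ 2 * (noise L a z.1 p ^ 2 + noise M b z.2 p ^ 2) -
        2 * ρ p * (noise L a z.1 p * noise M b z.2 p)) / (2 * (1 - ρ p ^ 2))) π :=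
      (i12.sub i33).div_const _
    unfold corrLogDensity
    refine ⟨(integrable_const _).sub i4, ?_⟩
    rw [integral_sub (integrable_const _) i4, integral_const, integral_div, integral_sub i12 i33,
      integral_const_mul, integral_const_mul, integral_add i1 i2,
      integral_sq_of_map_eq_gaussianReal (by fun_prop) (hπ.map_noise_fst hL p),
      integral_sq_of_map_eq_gaussianReal (by fun_prop) (hπ.map_noise_snd hM p)]
    simp
    ring
  unfold logDensity
  refine ⟨integrable_finsetSum _ fun p _ => (key p).1, ?_⟩
  rw [integral_finsetSum _ fun p _ => (key p).1]
  exact Finset.sum_congr rfl fun p _ => (key p).2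

theorem IsCoupling.ofReal_le_klDiv [IsProbabilityMeasure π]
    (hπ : IsCoupling (multivariateGaussian a (L * Lᵀ)) (multivariateGaussian b (M * Mᵀ)) π)
    (hL : IsUnit L.det) (hM : IsUnit M.det) (hρ : ∀ p, ρ p ^ 2 < 1) :
    ENNReal.ofReal (∫ z, logDensity L M a b ρ z ∂π) ≤ InformationTheory.klDiv π
      ((multivariateGaussian a (L * Lᵀ)).prod (multivariateGaussian b (M * Mᵀ))) := by
  have hm := measurable_logDensity (L := L) (M := M) (a := a) (b := b) ρ
  have hp := isProbabilityMeasure_corrCoupling (L := L) (M := M) (a := a) (b := b) hρ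
  have h1 := hp.measure_univ
  rw [corrCoupling_eq_withDensity hL hM hρ, withDensity_apply _ .univ, Measure.restrict_univ] at h1
  have hint : Integrable (fun z => Real.exp (logDensity L M a b ρ z))
      ((multivariateGaussian a (L * Lᵀ)).prod (multivariateGaussian b (M * Mᵀ))) := by
    refine ⟨by fun_prop, ?_⟩
    rw [hasFiniteIntegral_iff_ofReal (ae_of_all _ fun z => (Real.exp_pos _).le), h1]
    exact ENNReal.one_lt_top
  refine ofReal_integral_le_klDiv π _ (hπ.integral_logDensity hL hM ρ).1 hint ?_
  rw [integral_eq_lintegral_of_nonneg_ae (ae_of_all _ fun z => (Real.exp_pos _).le) (by fun_prop),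
    h1, ENNReal.toReal_one]

theorem klDiv_corrCoupling (hL : IsUnit L.det) (hM : IsUnit M.det) (hρ : ∀ p, ρ p ^ 2 < 1) :
    InformationTheory.klDiv (corrCoupling L M a b ρ)
      ((multivariateGaussian a (L * Lᵀ)).prod (multivariateGaussian b (M * Mᵀ))) =
      ENNReal.ofReal (∑ p, -(Real.log (1 - ρ p ^ 2)) / 2) := by
  have hp := isProbabilityMeasure_corrCoupling (L := L) (M := M) (a := a) (b := b) hρ
  obtain ⟨h1, h2⟩ := (isCoupling_corrCoupling (L := L) (M := M) (a := a) (b := b)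
    hρ).integral_logDensity hL hM ρ
  rw [klDiv_withDensity_exp _ _ (measurable_logDensity ρ) h1
    (corrCoupling_eq_withDensity hL hM hρ), h2]
  congr 1
  refine Finset.sum_congr rfl fun p _ => ?_
  rw [integral_noise_mul_noise_corrCoupling hL hM hρ]
  ring

end

/-! ### The closed formula for diagonal blocks that are diagonal -/

theorem self_mul_sign (n : ℝ) : n * Real.sign n = |n| := by
  rcases lt_trichotomy n 0 with h | h | h
  · rw [Real.sign_of_neg h, abs_of_neg h]; ring
  · simp [h]
  · rw [Real.sign_of_pos h, abs_of_pos h]; ring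

/-- The first-order condition that characterises `fLam lam n`: it is the critical point in `(-1, 1)`
of `ρ ↦ -2 n ρ - (lam / 2) log (1 - ρ ^ 2)`. -/
theorem one_sub_fLam_sq {lam : ℝ} (hlam : 0 < lam) (n : ℝ) :
    fLam lam n ^ 2 < 1 ∧ lam * fLam lam n = 2 * n * (1 - fLam lam n ^ 2) := by
  by_cases hn : n = 0
  · simp [fLam, hn]
  have hn' : 0 < |n| := abs_pos.2 hn
  set c := lam / (4 * |n|) with hc
  have hcpos : 0 < c := by positivity
  have hs : √(c ^ 2 + 1) ^ 2 = c ^ 2 + 1 := Real.sq_sqrt (by positivity)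
  have hsc : c < √(c ^ 2 + 1) := Real.lt_sqrt_of_sq_lt (by linarith)
  have hf : fLam lam n = Real.sign n * (√(c ^ 2 + 1) - c) := by rw [fLam, if_neg hn]
  have hsign : Real.sign n ^ 2 = 1 := by
    rcases lt_or_gt_of_ne hn with h | h
    · simp [Real.sign_of_neg h]
    · simp [Real.sign_of_pos h]
  have hsq : 1 - fLam lam n ^ 2 = 2 * c * (√(c ^ 2 + 1) - c) := by
    rw [hf, mul_pow, hsign]; linear_combination -hs
  have hlamc : lam = 4 * |n| * c := by rw [hc]; field_simp
  constructor
  · have : 0 < 2 * c * (√(c ^ 2 + 1) - c) := by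
      have := sub_pos.2 hsc
      positivity
    linarith
  · rw [hsq, hf, hlamc]
    have : |n| * Real.sign n = n := by
      rw [← self_mul_sign]
      linear_combination n * hsign
    linear_combination (4 * c * (√(c ^ 2 + 1) - c)) * this

theorem fLam_zero (n : ℝ) : fLam 0 n = Real.sign n := by
  unfold fLam
  split_ifs with h <;> simp [h]

theorem closedForm_diagonal_zero {A B : Matrix (Fin T × Fin d) (Fin T × Fin d) ℝ}
    (n : Fin T × Fin d → ℝ) :
    closedForm 0 a b A B (Matrix.diagonal n) = ‖a - b‖ ^ 2 + (A + B).trace - 2 * ∑ p, |n p| := by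
  rw [closedForm, Matrix.diagonal_map (by simp [fLam]), Matrix.diagonal_mul_diagonal,
    Matrix.trace_diagonal]
  simp only [fLam_zero, mul_comm (Real.sign _), self_mul_sign]
  ring

theorem closedForm_diagonal {A B : Matrix (Fin T × Fin d) (Fin T × Fin d) ℝ} {lam : ℝ}
    (hlam : 0 < lam) (n : Fin T × Fin d → ℝ) :
    closedForm lam a b A B (Matrix.diagonal n) = ‖a - b‖ ^ 2 + (A + B).trace -
      2 * (∑ p, n p * fLam lam (n p)) +
        lam * ∑ p, -(Real.log (1 - fLam lam (n p) ^ 2)) / 2 := by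
  have h : (1 - (Matrix.diagonal n).map (fLam lam) ^ 2).det = ∏ p, (1 - fLam lam (n p) ^ 2) := by
    rw [Matrix.diagonal_map (by simp [fLam]), Matrix.diagonal_pow, ← Matrix.diagonal_one,
      Matrix.diagonal_sub, Matrix.det_diagonal]
    rfl
  rw [closedForm, h, Real.log_prod fun p _ => by
      have := (one_sub_fLam_sq hlam (n p)).1
      linarith, Matrix.diagonal_map (by simp [fLam]),
    Matrix.diagonal_mul_diagonal, Matrix.trace_diagonal]
  have h2 : ∑ p, -(Real.log (1 - fLam lam (n p) ^ 2)) / 2 =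
      -(∑ p, Real.log (1 - fLam lam (n p) ^ 2)) / 2 := by
    rw [← Finset.sum_div, Finset.sum_neg_distrib]
  rw [h2]
  simp only [mul_comm (fLam lam _)]
  ring

theorem entropicAWSq_le (hL : IsBlockLower L) (hdetL : IsUnit L.det)
    (hM : IsBlockLower M) (hdetM : IsUnit M.det)
    (hdiag : ∀ p q : Fin T × Fin d, p.1 = q.1 → p ≠ q → (Mᵀ * L) p q = 0) {lam : ℝ}
    (hlam : 0 ≤ lam) {ρ : Fin T × Fin d → ℝ} (hρ : ∀ p, ρ p ^ 2 < 1) :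
    0 ≤ ‖a - b‖ ^ 2 + (L * Lᵀ + M * Mᵀ).trace - 2 * (∑ p, (Mᵀ * L) p p * ρ p) +
      lam * ∑ p, -(Real.log (1 - ρ p ^ 2)) / 2 ∧
    entropicAWSq lam (multivariateGaussian a (L * Lᵀ)) (multivariateGaussian b (M * Mᵀ)) ≤
      ENNReal.ofReal (‖a - b‖ ^ 2 + (L * Lᵀ + M * Mᵀ).trace - 2 * (∑ p, (Mᵀ * L) p p * ρ p) +
        lam * ∑ p, -(Real.log (1 - ρ p ^ 2)) / 2) := by
  have hp := isProbabilityMeasure_corrCoupling (L := L) (M := M) (a := a) (b := b) hρ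
  have hbc := isBicausalCoupling_corrCoupling (a := a) (b := b) hL hdetL hM hdetM hρ
  obtain ⟨h0, h1⟩ := hbc.lintegral_norm_sq hL hdetL hM hdetM hdiag
  simp only [integral_noise_mul_noise_corrCoupling hdetL hdetM hρ] at h0 h1
  have h2 : 0 ≤ ∑ p, -(Real.log (1 - ρ p ^ 2)) / 2 := by
    refine Finset.sum_nonneg fun p _ => ?_
    have := Real.log_nonpos (by linarith [hρ p]) (by linarith [sq_nonneg (ρ p)] : 1 - ρ p ^ 2 ≤ 1)
    linarith
  refine ⟨by positivity, ?_⟩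
  refine (iInf₂_le (⟨corrCoupling L M a b ρ, hp⟩ : ProbabilityMeasure _) hbc).trans ?_
  change entropicCost lam _ _ (corrCoupling L M a b ρ) ≤ _
  rw [entropicCost, h1, klDiv_corrCoupling hdetL hdetM hρ, ← ENNReal.ofReal_mul hlam,
    ← ENNReal.ofReal_add h0 (by positivity)]

theorem le_entropicAWSq (hL : IsBlockLower L) (hdetL : IsUnit L.det)
    (hM : IsBlockLower M) (hdetM : IsUnit M.det)
    (hdiag : ∀ p q : Fin T × Fin d, p.1 = q.1 → p ≠ q → (Mᵀ * L) p q = 0) {lam : ℝ}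
    (hlam : 0 < lam) {ρ : Fin T × Fin d → ℝ} (hρ : ∀ p, ρ p ^ 2 < 1)
    (hopt : ∀ p, lam * ρ p = 2 * (Mᵀ * L) p p * (1 - ρ p ^ 2)) :
    ENNReal.ofReal (‖a - b‖ ^ 2 + (L * Lᵀ + M * Mᵀ).trace - 2 * (∑ p, (Mᵀ * L) p p * ρ p) +
        lam * ∑ p, -(Real.log (1 - ρ p ^ 2)) / 2) ≤
    entropicAWSq lam (multivariateGaussian a (L * Lᵀ)) (multivariateGaussian b (M * Mᵀ)) := by
  refine le_iInf₂ fun π hπ => ?_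
  have h1 := (hπ.lintegral_norm_sq hL hdetL hM hdetM hdiag).2
  have h2 := hπ.1.ofReal_le_klDiv hdetL hdetM hρ
  rw [(hπ.1.integral_logDensity hdetL hdetM ρ).2] at h2
  obtain ⟨c, hc⟩ : ∃ c : Fin T × Fin d → ℝ, ∀ p, ∫ z, noise L a z.1 p * noise M b z.2 p
    ∂(π : Measure (PathSpace T d × PathSpace T d)) = c p := ⟨_, fun _ => rfl⟩
  simp only [hc] at h1 h2
  rw [entropicCost, h1]
  refine le_trans ?_ (add_le_add_right (mul_le_mul_right h2 _) _)
  rw [← ENNReal.ofReal_mul hlam.le]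
  refine le_trans (ENNReal.ofReal_le_ofReal (le_of_eq ?_)) ENNReal.ofReal_add_le
  -- By the first-order condition the unknown correlations `c p` cancel from the bound.
  have h3 : ∀ p, lam * (-(Real.log (1 - ρ p ^ 2)) / 2 -
      (2 * ρ p ^ 2 - 2 * ρ p * c p) / (2 * (1 - ρ p ^ 2))) =
      lam * (-(Real.log (1 - ρ p ^ 2)) / 2) - 2 * ((Mᵀ * L) p p * ρ p) +
        2 * ((Mᵀ * L) p p * c p) := by
    intro p
    have h4 : (2 * ρ p ^ 2 - 2 * ρ p * c p) / (2 * (1 - ρ p ^ 2)) * lam =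
        2 * (Mᵀ * L) p p * (ρ p - c p) := by
      have h5 : 1 - ρ p ^ 2 ≠ 0 := by linarith [hρ p]
      field_simp
      linear_combination (ρ p - c p) * hopt p
    linear_combination -h4
  have h6 := Finset.sum_congr (rfl : (Finset.univ : Finset (Fin T × Fin d)) = _) fun p _ => h3 p
  rw [Finset.sum_add_distrib, Finset.sum_sub_distrib, ← Finset.mul_sum, ← Finset.mul_sum,
    ← Finset.mul_sum, ← Finset.mul_sum] at h6
  rw [h6]
  ring

theorem le_entropicAWSq_zero (hL : IsBlockLower L) (hdetL : IsUnit L.det)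
    (hM : IsBlockLower M) (hdetM : IsUnit M.det)
    (hdiag : ∀ p q : Fin T × Fin d, p.1 = q.1 → p ≠ q → (Mᵀ * L) p q = 0) :
    ENNReal.ofReal (‖a - b‖ ^ 2 + (L * Lᵀ + M * Mᵀ).trace - 2 * (∑ p, |(Mᵀ * L) p p|)) ≤
    entropicAWSq 0 (multivariateGaussian a (L * Lᵀ)) (multivariateGaussian b (M * Mᵀ)) := by
  refine le_iInf₂ fun π hπ => ?_
  rw [entropicCost, (hπ.lintegral_norm_sq hL hdetL hM hdetM hdiag).2, ENNReal.ofReal_zero, zero_mul,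
    add_zero]
  refine ENNReal.ofReal_le_ofReal ?_
  gcongr with p _
  set c := ∫ z, noise L a z.1 p * noise M b z.2 p 
    ∂(π : Measure (PathSpace T d × PathSpace T d)) with hc
  have hcle : |c| ≤ 1 := by
    have i1 := (hπ.1.memLp_noise_fst hdetL p).integrable_sq
    have i2 := (hπ.1.memLp_noise_snd hdetM p).integrable_sq
    have e1 := integral_sq_of_map_eq_gaussianReal (by fun_prop) (hπ.1.map_noise_fst hdetL p)
    have e2 := integral_sq_of_map_eq_gaussianReal (by fun_prop) (hπ.1.map_noise_snd hdetM p)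
    have i3 := hπ.1.integrable_noise_mul_noise hdetL hdetM p p
    calc |c| ≤ ∫ z, |noise L a z.1 p * noise M b z.2 p| ∂(π : Measure (PathSpace T d × PathSpace T d)) :=
          abs_integral_le_integral_abs
      _ ≤ ∫ z, (noise L a z.1 p ^ 2 + noise M b z.2 p ^ 2) / 2 ∂(π : Measure (PathSpace T d × PathSpace T d)) := by
          refine integral_mono i3.abs ((i1.add i2).div_const 2) fun z => ?_
          change |noise L a z.1 p * noise M b z.2 p| ≤
            (noise L a z.1 p ^ 2 + noise M b z.2 p ^ 2) / 2
          rw [abs_le]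
          constructor <;> nlinarith [sq_nonneg (noise L a z.1 p - noise M b z.2 p),
            sq_nonneg (noise L a z.1 p + noise M b z.2 p)]
      _ = 1 := by
          rw [integral_div, integral_add i1 i2, e1, e2]; norm_num
  calc (Mᵀ * L) p p * c ≤ |(Mᵀ * L) p p * c| := le_abs_self _
    _ = |(Mᵀ * L) p p| * |c| := abs_mul _ _
    _ ≤ |(Mᵀ * L) p p| * 1 := by gcongr
    _ = _ := mul_one _

/-- The closed formula when the diagonal blocks of `Mᵀ L` are diagonal, with entries of any sign. -/
theorem entropicAWSq_eq (hL : IsBlockLower L) (hdetL : IsUnit L.det)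
    (hM : IsBlockLower M) (hdetM : IsUnit M.det)
    (hdiag : ∀ p q : Fin T × Fin d, p.1 = q.1 → p ≠ q → (Mᵀ * L) p q = 0) {lam : ℝ}
    (hlam : 0 ≤ lam) :
    0 ≤ closedForm lam a b (L * Lᵀ) (M * Mᵀ) (Matrix.diagonal fun p => (Mᵀ * L) p p) ∧
    entropicAWSq lam (multivariateGaussian a (L * Lᵀ)) (multivariateGaussian b (M * Mᵀ)) =
      ENNReal.ofReal
        (closedForm lam a b (L * Lᵀ) (M * Mᵀ) (Matrix.diagonal fun p => (Mᵀ * L) p p)) := by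
  rcases hlam.eq_or_lt with rfl | hlam
  · rw [closedForm_diagonal_zero]
    -- The optimal correlations `±1` are approached by `r * sign n` with `r ↑ 1`.
    have hr : ∀ r : ℝ, r ∈ Set.Ico (0 : ℝ) 1 →
        ∀ p, (r * Real.sign ((Mᵀ * L) p p)) ^ 2 < 1 := by
      intro r hr p
      have h1 : r ^ 2 < 1 := by nlinarith [hr.1, hr.2]
      rcases lt_trichotomy ((Mᵀ * L) p p) 0 with h | h | h
      · simpa [Real.sign_of_neg h] using h1
      · simp [h]
      · simpa [Real.sign_of_pos h] using h1
    have hsum : ∀ r : ℝ, ∑ p, (Mᵀ * L) p p * (r * Real.sign ((Mᵀ * L) p p)) =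
        r * ∑ p, |(Mᵀ * L) p p| := by
      intro r
      rw [Finset.mul_sum]
      refine Finset.sum_congr rfl fun p _ => ?_
      rw [← self_mul_sign]; ring
    have hub : ∀ r : ℝ, r ∈ Set.Ico (0 : ℝ) 1 → _ := fun r hr' =>
      entropicAWSq_le (a := a) (b := b) hL hdetL hM hdetM hdiag le_rfl (hr r hr')
    simp only [hsum, zero_mul, add_zero] at hub
    have hev : ∀ᶠ r : ℝ in 𝓝[<] 1, r ∈ Set.Ico (0 : ℝ) 1 :=
      Ico_mem_nhdsLT zero_lt_one
    have hlim : Tendsto (fun r : ℝ => ‖a - b‖ ^ 2 + (L * Lᵀ + M * Mᵀ).trace -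
        2 * (r * ∑ p, |(Mᵀ * L) p p|)) (𝓝[<] 1)
        (𝓝 (‖a - b‖ ^ 2 + (L * Lᵀ + M * Mᵀ).trace - 2 * ∑ p, |(Mᵀ * L) p p|)) := by
      have hcont : Continuous fun r : ℝ => ‖a - b‖ ^ 2 + (L * Lᵀ + M * Mᵀ).trace -
        2 * (r * ∑ p, |(Mᵀ * L) p p|) := by fun_prop
      have := (hcont.tendsto 1).mono_left (nhdsWithin_le_nhds (s := Set.Iio 1))
      simpa using this
    refine ⟨ge_of_tendsto hlim (hev.mono fun r hr' => (hub r hr').1), le_antisymm ?_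
      (le_entropicAWSq_zero hL hdetL hM hdetM hdiag)⟩
    exact ge_of_tendsto ((ENNReal.continuous_ofReal.tendsto _).comp hlim)
      (hev.mono fun r hr' => (hub r hr').2)
  · rw [closedForm_diagonal hlam]
    have h := fun p => one_sub_fLam_sq hlam ((Mᵀ * L) p p)
    obtain ⟨h0, hle⟩ := entropicAWSq_le (a := a) (b := b) hL hdetL hM hdetM hdiag hlam.le
      fun p => (h p).1
    exact ⟨h0, le_antisymm hle
      (le_entropicAWSq hL hdetL hM hdetM hdiag hlam (fun p => (h p).1) fun p => (h p).2)⟩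

end Paths

/-! ### The limit of vanishing regularization -/

theorem tendsto_fLam (n : ℝ) : Tendsto (fun lam => fLam lam n) (𝓝[>] 0) (𝓝 (Real.sign n)) := by
  have hcont : Continuous fun lam => fLam lam n := by
    unfold fLam
    split_ifs <;> fun_prop
  have := (hcont.tendsto 0).mono_left (nhdsWithin_le_nhds (s := Set.Ioi 0))
  rwa [fLam_zero] at this

theorem tendsto_mul_log_one_sub_fLam_sq (n : ℝ) :
    Tendsto (fun lam => lam * (-(Real.log (1 - fLam lam n ^ 2)) / 2)) (𝓝[>] 0) (𝓝 0) := by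
  by_cases hn : n = 0
  · simp [fLam, hn]
  have hlim : Tendsto (fun lam => fLam lam n / (2 * n)) (𝓝[>] 0) (𝓝 (Real.sign n / (2 * n))) :=
    (tendsto_fLam n).div_const _
  have hsign : Real.sign n ≠ 0 := fun h => hn (Real.sign_eq_zero_iff.1 h)
  have hne : Real.sign n / (2 * n) ≠ 0 := div_ne_zero hsign (by simpa using hn)
  have hid : Tendsto (fun lam : ℝ => lam) (𝓝[>] 0) (𝓝 0) :=
    tendsto_id.mono_left nhdsWithin_le_nhds
  have h1 : Tendsto (fun lam : ℝ => lam * Real.log lam) (𝓝[>] 0) (𝓝 0) := by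
    have := (Real.continuous_mul_log.tendsto 0).mono_left (nhdsWithin_le_nhds (s := Set.Ioi 0))
    simpa using this
  have h2 := hid.mul (hlim.log hne)
  have h3 : Tendsto (fun lam => -(lam * Real.log lam + lam * Real.log (fLam lam n / (2 * n))) / 2)
      (𝓝[>] 0) (𝓝 0) := by
    simpa using ((h1.add h2).neg).div_const 2
  refine h3.congr' ?_
  filter_upwards [self_mem_nhdsWithin, hlim.eventually_ne hne] with lam hlam hlne
  -- The logarithm blows up only like `log lam`, which the factor `lam` compensates.
  have h4 : 1 - fLam lam n ^ 2 = lam * (fLam lam n / (2 * n)) := by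
    have := (one_sub_fLam_sq hlam n).2
    field_simp
    linarith
  rw [h4, Real.log_mul (ne_of_gt hlam) hlne]
  ring

section Limit

variable {T d : ℕ} {a b : PathSpace T d}

theorem tendsto_closedForm_diagonal (A B : Matrix (Fin T × Fin d) (Fin T × Fin d) ℝ)
    (n : Fin T × Fin d → ℝ) :
    Tendsto (fun lam => closedForm lam a b A B (Matrix.diagonal n)) (𝓝[>] 0)
      (𝓝 (closedForm 0 a b A B (Matrix.diagonal n))) := by
  rw [closedForm_diagonal_zero]
  have h1 : Tendsto (fun lam => ∑ p, n p * fLam lam (n p)) (𝓝[>] 0) (𝓝 (∑ p, |n p|)) := by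
    simp only [← self_mul_sign]
    exact tendsto_finsetSum _ fun p _ => (tendsto_fLam (n p)).const_mul _
  have h2 : Tendsto (fun lam => lam * ∑ p, -(Real.log (1 - fLam lam (n p) ^ 2)) / 2)
      (𝓝[>] 0) (𝓝 0) := by
    simp only [Finset.mul_sum]
    simpa using tendsto_finsetSum Finset.univ fun p _ => tendsto_mul_log_one_sub_fLam_sq (n p)
  have h3 := ((tendsto_const_nhds (x := ‖a - b‖ ^ 2 + (A + B).trace)).sub (h1.const_mul 2)).add h2
  rw [add_zero] at h3
  refine h3.congr' ?_
  filter_upwards [self_mem_nhdsWithin] with lam hlam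
  rw [closedForm_diagonal hlam]

/-! ### Reduction to diagonal blocks by singular value decomposition -/

/-- Singular value decomposition of a real square matrix, with Mathlib's ordered singular values. -/
theorem exists_svd (N : Matrix (Fin d) (Fin d) ℝ) :
    ∃ U V : Matrix (Fin d) (Fin d) ℝ, Uᵀ * U = 1 ∧ Vᵀ * V = 1 ∧
      Uᵀ * N * V = Matrix.diagonal fun i : Fin d => (Matrix.toEuclideanLin N).singularValues i := by
  set f := Matrix.toEuclideanLin N with hf
  have hn : Module.finrank ℝ (EuclideanSpace ℝ (Fin d)) = d := by simp
  set v := f.isSymmetric_adjoint_comp_self.eigenvectorBasis hn with hv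
  set s : Fin d → ℝ := fun i => f.singularValues i with hs
  have hinner : ∀ i j, inner ℝ (f (v i)) (f (v j)) = if i = j then s j ^ 2 else 0 := by
    intro i j
    have h1 : inner ℝ (f (v i)) (f (v j)) =
        inner ℝ (v i) ((LinearMap.adjoint f ∘ₗ f) (v j)) := by
      rw [LinearMap.comp_apply, LinearMap.adjoint_inner_right]
    rw [h1, hv, LinearMap.IsSymmetric.apply_eigenvectorBasis, ← hv, inner_smul_right,
      orthonormal_iff_ite.1 v.orthonormal i j, hs]
    simp only [f.sq_singularValues_fin hn]
    split_ifs <;> simp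
  have horth : Orthonormal ℝ (({i | s i ≠ 0} : Set (Fin d)).domRestrict
      fun i => (s i)⁻¹ • f (v i)) := by
    rw [orthonormal_iff_ite]
    rintro ⟨i, hi⟩ ⟨j, hj⟩
    have hj' : s j ≠ 0 := hj
    change inner ℝ ((s i)⁻¹ • f (v i)) ((s j)⁻¹ • f (v j)) = _
    rw [real_inner_smul_left, real_inner_smul_right, hinner]
    simp only [Subtype.mk.injEq]
    split_ifs with h
    · subst h; field_simp
    · simp
  obtain ⟨u, hu⟩ := horth.exists_orthonormalBasis_extension_of_card_eq (by simp)
  have hfv : ∀ j, f (v j) = s j • u j := by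
    intro j
    by_cases hj : s j = 0
    · have := hinner j j
      rw [if_pos rfl, hj] at this
      rw [hj, zero_smul]
      exact (inner_self_eq_zero (𝕜 := ℝ)).1 (by rw [this]; ring)
    · rw [hu j hj, smul_smul, mul_inv_cancel₀ hj, one_smul]
  have hmul : ∀ (x y : Fin d → EuclideanSpace ℝ (Fin d)) i j,
      ((Matrix.of fun r i => x i r)ᵀ * (Matrix.of fun r i => y i r)) i j =
        inner ℝ (x i) (y j) := by
    intro x y i j
    rw [Matrix.mul_apply, PiLp.inner_apply]
    exact Finset.sum_congr rfl fun r _ => by simp [mul_comm]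
  refine ⟨Matrix.of fun r i => u i r, Matrix.of fun r i => v i r, ?_, ?_, ?_⟩
  · ext i j
    rw [hmul, orthonormal_iff_ite.1 u.orthonormal i j, Matrix.one_apply]
  · ext i j
    rw [hmul, orthonormal_iff_ite.1 v.orthonormal i j, Matrix.one_apply]
  · have hNV : N * (Matrix.of fun r i => v i r) = Matrix.of fun r i => f (v i) r := by
      ext r i
      rfl
    ext i j
    rw [Matrix.mul_assoc, hNV, hmul, hfv, real_inner_smul_right,
      orthonormal_iff_ite.1 u.orthonormal i j, Matrix.diagonal_apply]
    split_ifs with h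
    · rw [h, mul_one]
    · rw [mul_zero]

/-- The matrix with diagonal blocks `V t`, with the time index first. `Matrix.blockDiagonal` has the
block index second, hence the swaps. -/
def timeBlockDiagonal (V : Fin T → Matrix (Fin d) (Fin d) ℝ) :
    Matrix (Fin T × Fin d) (Fin T × Fin d) ℝ :=
  (Matrix.blockDiagonal V).submatrix Prod.swap Prod.swap

theorem timeBlockDiagonal_apply (V : Fin T → Matrix (Fin d) (Fin d) ℝ) (p q : Fin T × Fin d) :
    timeBlockDiagonal V p q = if p.1 = q.1 then V p.1 p.2 q.2 else 0 := by
  simp [timeBlockDiagonal, Matrix.blockDiagonal_apply]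

theorem timeBlockDiagonal_mul_transpose {V : Fin T → Matrix (Fin d) (Fin d) ℝ}
    (hV : ∀ t, (V t)ᵀ * V t = 1) : timeBlockDiagonal V * (timeBlockDiagonal V)ᵀ = 1 := by
  rw [mul_eq_one_comm]
  ext p q
  rw [Matrix.mul_apply, Fintype.sum_prod_type]
  simp only [Matrix.transpose_apply, timeBlockDiagonal_apply, ite_mul, mul_ite, zero_mul, mul_zero]
  rw [Finset.sum_eq_single q.1 (fun t _ ht => by simp [ht]) (by simp)]
  have h := congrFun (congrFun (hV q.1) p.2) q.2
  rw [Matrix.mul_apply, Matrix.one_apply] at h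
  simp only [if_true]
  by_cases hpq : q.1 = p.1
  · simp only [if_pos hpq]
    rw [Matrix.one_apply]
    simpa [Prod.ext_iff, hpq] using h
  · simp only [if_neg hpq]
    rw [Matrix.one_apply_ne fun h' => hpq (by rw [h'])]
    simp

theorem timeBlockDiagonal_conj_apply (U V : Fin T → Matrix (Fin d) (Fin d) ℝ)
    (N : Matrix (Fin T × Fin d) (Fin T × Fin d) ℝ) (t : Fin T) (i j : Fin d) :
    ((timeBlockDiagonal U)ᵀ * N * timeBlockDiagonal V) (t, i) (t, j) =
      ((U t)ᵀ * diagBlock N t * V t) i j := by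
  simp only [Matrix.mul_apply, Matrix.transpose_apply, timeBlockDiagonal_apply,
    Fintype.sum_prod_type, ite_mul, mul_ite, zero_mul, mul_zero]
  rw [Finset.sum_eq_single t (fun s _ hs => by simp [hs]) (by simp)]
  simp only [if_true]
  refine Finset.sum_congr rfl fun k _ => ?_
  rw [Finset.sum_eq_single t (fun s _ hs => by simp [hs]) (by simp)]
  simp [diagBlock]

theorem IsBlockLower.mul_timeBlockDiagonal {L : Matrix (Fin T × Fin d) (Fin T × Fin d) ℝ}
    (hL : IsBlockLower L) (V : Fin T → Matrix (Fin d) (Fin d) ℝ) :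
    IsBlockLower (L * timeBlockDiagonal V) := by
  intro p q hpq
  rw [Matrix.mul_apply]
  refine Finset.sum_eq_zero fun r _ => ?_
  rw [timeBlockDiagonal_apply]
  split_ifs with h
  · rw [hL p r (h ▸ hpq), zero_mul]
  · rw [mul_zero]

/-- The block lower triangular square roots of the covariances can be multiplied by block diagonal
orthogonal matrices so that the diagonal blocks of `Mᵀ L` become diagonal, with the singular values
as entries. -/
theorem exists_factor_singularDiag {L M : Matrix (Fin T × Fin d) (Fin T × Fin d) ℝ}
    (hL : IsBlockLower L) (hM : IsBlockLower M) :
    ∃ L' M' : Matrix (Fin T × Fin d) (Fin T × Fin d) ℝ, IsBlockLower L' ∧ IsBlockLower M' ∧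
      L' * L'ᵀ = L * Lᵀ ∧ M' * M'ᵀ = M * Mᵀ ∧
      (∀ p q : Fin T × Fin d, p.1 = q.1 → p ≠ q → (M'ᵀ * L') p q = 0) ∧
      (Matrix.diagonal fun p => (M'ᵀ * L') p p) = singularDiag (Mᵀ * L) := by
  choose U V hU hV hUV using fun t => exists_svd (diagBlock (Mᵀ * L) t)
  have hmul : (M * timeBlockDiagonal U)ᵀ * (L * timeBlockDiagonal V) =
      (timeBlockDiagonal U)ᵀ * (Mᵀ * L) * timeBlockDiagonal V := by
    rw [Matrix.transpose_mul]
    simp only [Matrix.mul_assoc]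
  have hentry : ∀ t i j, ((M * timeBlockDiagonal U)ᵀ * (L * timeBlockDiagonal V)) (t, i) (t, j) =
      Matrix.diagonal (fun i : Fin d =>
        (Matrix.toEuclideanLin (diagBlock (Mᵀ * L) t)).singularValues i) i j := by
    intro t i j
    rw [hmul, timeBlockDiagonal_conj_apply, hUV]
  have hfac : ∀ (K : Matrix (Fin T × Fin d) (Fin T × Fin d) ℝ)
      (W : Fin T → Matrix (Fin d) (Fin d) ℝ), (∀ t, (W t)ᵀ * W t = 1) →
      K * timeBlockDiagonal W * (K * timeBlockDiagonal W)ᵀ = K * Kᵀ := by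
    intro K W hW
    rw [Matrix.transpose_mul, Matrix.mul_assoc, ← Matrix.mul_assoc (timeBlockDiagonal W),
      timeBlockDiagonal_mul_transpose hW, Matrix.one_mul]
  refine ⟨L * timeBlockDiagonal V, M * timeBlockDiagonal U, hL.mul_timeBlockDiagonal V,
    hM.mul_timeBlockDiagonal U, hfac L V hV, hfac M U hU, ?_, ?_⟩
  · rintro ⟨t, i⟩ ⟨s, j⟩ rfl hne
    rw [hentry, Matrix.diagonal_apply_ne _ fun h => hne (by rw [h])]
  · rw [singularDiag]
    congr 1
    funext p
    exact (hentry p.1 p.2 p.2).trans (Matrix.diagonal_apply_eq _ _)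

theorem isUnit_det_of_posDef {L : Matrix (Fin T × Fin d) (Fin T × Fin d) ℝ}
    (h : (L * Lᵀ).PosDef) : IsUnit L.det := by
  have := h.det_pos
  rw [Matrix.det_mul, Matrix.det_transpose] at this
  exact isUnit_iff_ne_zero.2 fun h0 => by simp [h0] at this

theorem adaptedWSq_eq_entropicAWSq_zero (μ ν : Measure (PathSpace T d)) [IsFiniteMeasure μ]
    [IsFiniteMeasure ν] : adaptedWSq μ ν = entropicAWSq 0 μ ν := by
  simp [adaptedWSq, entropicAWSq, entropicCost]

end Limit

end AdaptedOT

theorem theorem2p3 (T d : ℕ) (a b : AdaptedOT.PathSpace T d)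
    (A B L M : Matrix (Fin T × Fin d) (Fin T × Fin d) ℝ)
    (hA : A.PosDef) (hB : B.PosDef)
    (hL : AdaptedOT.IsLowerTriangular L) (hM : AdaptedOT.IsLowerTriangular M)
    (hAL : A = L * Lᵀ) (hBM : B = M * Mᵀ) :
    -- the closed formula for every `lam ≥ 0`
    (∀ lam : ℝ, 0 ≤ lam →
      ((AdaptedOT.entropicAWSq lam (multivariateGaussian a A) (multivariateGaussian b B) : ℝ≥0∞) :
          EReal) =
        ((AdaptedOT.closedForm lam a b A B (AdaptedOT.singularDiag (Mᵀ * L)) : ℝ) : EReal)) ∧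
    -- the case `lam = 0`
    (∀ x : ℝ, AdaptedOT.fLam 0 x = Real.sign x) ∧
    ((AdaptedOT.adaptedWSq (multivariateGaussian a A) (multivariateGaussian b B) : ℝ≥0∞) :
        EReal) =
      ((‖a - b‖ ^ 2 + (A + B).trace - 2 * (AdaptedOT.singularDiag (Mᵀ * L)).trace : ℝ) :
        EReal) ∧
    -- convergence as `lam` decreases to `0`
    Tendsto
      (fun lam : ℝ =>
        AdaptedOT.entropicAWSq lam (multivariateGaussian a A) (multivariateGaussian b B))
      (𝓝[>] 0)
      (𝓝 (AdaptedOT.adaptedWSq (multivariateGaussian a A) (multivariateGaussian b B))) ∧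
    -- the one-dimensional case, with the diagonal part of `Mᵀ * L` in place of singular values
    (d = 1 → ∀ lam : ℝ, 0 ≤ lam →
      ((AdaptedOT.entropicAWSq lam (multivariateGaussian a A) (multivariateGaussian b B) : ℝ≥0∞) :
          EReal) =
        ((AdaptedOT.closedForm lam a b A B
          (Matrix.diagonal fun p => (Mᵀ * L) p p) : ℝ) : EReal)) := by
  open AdaptedOT in
  subst hAL hBM
  have hLb : IsBlockLower L := fun p q h => hL p q (Or.inl h)
  have hMb : IsBlockLower M := fun p q h => hM p q (Or.inl h)
  have hform : ∀ lam : ℝ, 0 ≤ lam →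
      0 ≤ closedForm lam a b (L * Lᵀ) (M * Mᵀ) (singularDiag (Mᵀ * L)) ∧
      entropicAWSq lam (multivariateGaussian a (L * Lᵀ)) (multivariateGaussian b (M * Mᵀ)) =
        ENNReal.ofReal (closedForm lam a b (L * Lᵀ) (M * Mᵀ) (singularDiag (Mᵀ * L))) := by
    obtain ⟨L', M', hL', hM', hLL, hMM, hdiag, hS⟩ := exists_factor_singularDiag hLb hMb
    intro lam hlam
    rw [← hS]
    rw [← hLL] at hA ⊢
    rw [← hMM] at hB ⊢
    exact entropicAWSq_eq hL' (isUnit_det_of_posDef hA) hM' (isUnit_det_of_posDef hB) hdiag hlam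
  refine ⟨fun lam hlam => ?_, fLam_zero, ?_, ?_, ?_⟩
  · obtain ⟨h0, h⟩ := hform lam hlam
    rw [h, EReal.coe_ennreal_ofReal, max_eq_left h0]
  · obtain ⟨h0, h⟩ := hform 0 le_rfl
    rw [adaptedWSq_eq_entropicAWSq_zero, h, EReal.coe_ennreal_ofReal, max_eq_left h0, singularDiag,
      closedForm_diagonal_zero, Matrix.trace_diagonal]
    simp only [abs_of_nonneg (LinearMap.singularValues_nonneg _ _)]
  · rw [adaptedWSq_eq_entropicAWSq_zero, (hform 0 le_rfl).2]
    refine ((ENNReal.continuous_ofReal.tendsto _).comp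
      (tendsto_closedForm_diagonal (a := a) (b := b) (L * Lᵀ) (M * Mᵀ) _)).congr' ?_
    filter_upwards [self_mem_nhdsWithin] with lam hlam
    exact (hform lam (le_of_lt hlam)).2.symm
  · rintro rfl lam hlam
    obtain ⟨h0, h⟩ := entropicAWSq_eq (a := a) (b := b) hLb (isUnit_det_of_posDef hA) hMb
      (isUnit_det_of_posDef hB)
      (fun p q h1 h2 => absurd (Prod.ext h1 (Subsingleton.elim _ _)) h2) hlam
    rw [h, EReal.coe_ennreal_ofReal, max_eq_left h0]
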